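/- **Setting.** A weighted oriented graph $D=(G,\mathcal O,w)$ consists of a finite simple graph $G$, an orientation $\mathcal O$ of its edges (each edge gets exactly one of its two directions; $E(D)$ is the set of oriented edges), and a weight function $w:V(G)\to\{1,2,3,\dots\}$. Put $V^+=\{x : w(x)>1\}$, $N_D^+(x)=\{y:(x,y)\in E(D)\}$, $N_D^-(x)=\{y:(y,x)\in E(D)\}$, $N_D(x)=N_D^+(x)\cup N_D^-(x)$, $N_D^+(A)=\bigcup_{x\in A}N_D^+(x)$. It is assumed throughout that $w(x)=1$ whenever $x$ is a source, i.e. $N_D^-(x)=\emptyset$. For a field $K$, the edge ideal is $I(D)=(x\,y^{w(y)} : (x,y)\in E(D))$ in the polynomial ring over $K$ whose variables are the vertices. An ideal is unmixed if all its associated primes have the same height. **SCQ graphs.** A simplex of $G$ is a complete induced subgraph of the form $G[N_G[v]]$, where $N_G[v]$ is the closed neighbourhood of a vertex $v$; $S_G$ is the set of simplexes. A basic $5$-cycle is an induced $5$-cycle of $G$ that does not contain two adjacent vertices of degree at least three in $G$; $C_G$ is the set of basic $5$-cycles. An edge $e$ has property (P) if, whenever $e=\{b,b'\}$ and $\{a,b\},\{a',b'\}\in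 E(G)$, then $\{a,a'\}\in E(G)$ (in particular $a\neq a'$). $G$ is an SCQ graph if there is a (possibly empty) set $Q_G$ of pairwise disjoint edges, each with property (P), such that $\{V(H) : H\in S_G\cup C_G\cup Q_G\}$ is a partition of $V(G)$. **The $\star$-property.** An induced $5$-cycle $C$ has the $\star$-property if for every oriented edge $(a,b)$ of $C$ with $a\in V^+$, writing $C=(a',a,b,b',c,a')$, one has: $(\star.1)$ $(a',a)\in E(D)$ and $w(a')=1$; $(\star.2)$ $N_D^-(a)\subseteq N_D(c)$ and $N_D^-(a)\cap V^+\subseteq N_D^-(c)$; $(\star.3)$ $N_D(b')\subseteq N_D(a')\cup N_D^+(a)$ and $N_D^-(b')\cap V^+\subseteq N_D^-(a')$. **$\star$-semi-forests.** Subgraphs of $D$ carry the orientation and the weights of $D$. A root oriented tree with parent $v$ is a subgraph $T$ of $D$ without cycles, with $v\in V(T)$, such that for each $x\in V(T)\setminus\{v\}$ there is an oriented path in $T$ from $v$ to $x$, and such that each $x\in V(T)$ with $w(x)=1$ satisfies either $\deg_T(x)=1$ and $x\ne v$, or $V(T)=\{v\}$ and $x=v$. A unicycle oriented subgraph is a subgraph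 $B$ of $D$ with exactly one cycle $C$, such that $C$ is an oriented cycle, for each $y\in V(B)\setminus V(C)$ there is an oriented path in $B$ from a vertex of $C$ to $y$, and each $x\in V(B)$ with $w(x)=1$ has $\deg_B(x)=1$. A $\star$-semi-forest is a subgraph $H$ of $D$ that is a union $T_1\cup\dots\cup T_r\cup B_1\cup\dots\cup B_s$ ($r,s\ge 0$) of root oriented trees $T_i$ with parents $v_i$ and unicycle oriented subgraphs $B_j$, such that: (i) $V(T_1),\dots,V(T_r),V(B_1),\dots,V(B_s)$ is a partition of $V(H)$; (ii) there are (not necessarily distinct) $w_1,\dots,w_r\in V(D)\setminus V(H)$ with $w_i\in N_D(v_i)$; (iii) $W=\{w_1,\dots,w_r\}$ is a disjoint union $W_1\cup W_2$ (either set possibly empty) where $W_1$ contains no two adjacent vertices, $W_2\subseteq V^+$, $(w_i,v_i)\in E(D)$ whenever $w_i\in W_2$, and $N_D^+(W_2\cup\tilde H)\cap W_1=\emptyset$ with $\tilde H=\{x\in V(H):\deg_H(x)\ge 2\}\cup\{v_i:\deg_H(v_i)=1\}$. A subgraph $L$ of $D$ has a generating $\star$-semi-forest if there is a $\star$-semi-forest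 $H$ of $D$ with $V(H)=V(L)$. **Theorem.** Let $D=(G,\mathcal O,w)$ be a weighted oriented graph, all of whose sources have weight one, whose underlying graph $G$ is an SCQ graph, with $Q_G$ as above, and let $K$ be a field. Then $I(D)$ is unmixed if and only if the following three conditions hold: (a) each basic $5$-cycle of $G$ has the $\star$-property; (b) no simplex of $D$ has a generating $\star$-semi-forest; (c) $N_D(b)\subseteq N_D^+(a)$ whenever $a\in V^+$, $\{b,b'\}\in Q_G$ and $b'\in N_D^+(a)$. -/

import Mathlib

/-- An ideal is unmixed if all its associated primes have the same height. -/
def IdealIsUnmixed {R : Type*} [CommRing R] (I : Ideal R) : Prop :=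
  ∀ p ∈ associatedPrimes R (R ⧸ I), ∀ q ∈ associatedPrimes R (R ⧸ I), p.height = q.height

/-! ### SCQ graphs -/

namespace SCQ

variable {V : Type*} (G : SimpleGraph V)

/-- The closed neighbourhood `N_G[v]`. -/
def closedNbr (v : V) : Set V := insert v (G.neighborSet v)

/-- The degree of a vertex (the vertex set is finite in all uses). -/
noncomputable def deg (v : V) : ℕ := (G.neighborSet v).ncard

/-- The simplexes of `G`: the sets `N_G[v]` that induce a complete graph. A simplex is an induced
subgraph, so it is given by its vertex set. -/
def simplexes : Set (Set V) := {A | ∃ v, A = closedNbr G v ∧ G.IsClique A}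

/-- An induced 5-cycle `(z 0, z 1, z 2, z 3, z 4, z 0)` of `G` is a graph embedding `z` of the cycle
graph on five vertices. It is basic if it does not contain two adjacent vertices that both have
degree at least three in `G`. -/
def IsBasic (z : SimpleGraph.cycleGraph 5 ↪g G) : Prop :=
  ∀ i j, G.Adj (z i) (z j) → ¬ (3 ≤ deg G (z i) ∧ 3 ≤ deg G (z j))

/-- The basic 5-cycles of `G`; being induced subgraphs, they are given by their vertex sets. -/
def basicFiveCycles : Set (Set V) :=
  {A | ∃ z : SimpleGraph.cycleGraph 5 ↪g G, IsBasic G z ∧ Set.range z = A}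

/-- A set of pairwise disjoint edges. -/
def IsMatching (Q : Set (Sym2 V)) : Prop :=
  Q ⊆ G.edgeSet ∧ ∀ e ∈ Q, ∀ f ∈ Q, e ≠ f → ∀ x, ¬ (x ∈ e ∧ x ∈ f)

/-- Property (P) of an edge `e = {b, b'}`: for all edges `{a, b}` and `{a', b'}` of `G`, also
`{a, a'}` is an edge of `G` (in particular `a ≠ a'`). -/
def PropertyP (e : Sym2 V) : Prop :=
  ∀ a b a' b', e = s(b, b') → G.Adj a b → G.Adj a' b' → G.Adj a a'

/-- `G` is an SCQ graph, `Q` being the matching `Q_G`. -/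
structure IsSCQ (Q : Set (Sym2 V)) : Prop where
  matching : IsMatching G Q
  propertyP : ∀ e ∈ Q, PropertyP G e
  partition : Setoid.IsPartition
    (simplexes G ∪ basicFiveCycles G ∪ {A : Set V | ∃ e ∈ Q, A = {x | x ∈ e}})

end SCQ

/-! ### Weighted oriented graphs -/

/-- A weighted oriented graph `D = (G, O, w)` with vertex set `V`: a simple graph in which every edge
is given exactly one of its two directions, and a positive integer weight on every vertex. -/
structure WOGraph (V : Type*) where
  graph : SimpleGraph V
  arc : V → V → Prop
  adj_iff : ∀ x y, graph.Adj x y ↔ arc x y ∨ arc y x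
  asymm : ∀ x y, arc x y → ¬ arc y x
  weight : V → ℕ
  weight_pos : ∀ x, 1 ≤ weight x

namespace WOGraph

variable {V : Type*} (D : WOGraph V)

/-- The out-neighbourhood `N_D^+(x)`. -/
def outNbr (x : V) : Set V := {y | D.arc x y}

/-- The in-neighbourhood `N_D^-(x)`. -/
def inNbr (x : V) : Set V := {y | D.arc y x}

/-- The neighbourhood `N_D(x)`. -/
def nbr (x : V) : Set V := D.outNbr x ∪ D.inNbr x

/-- The set `V^+` of the vertices of weight greater than one. -/
def plus : Set V := {x | 1 < D.weight x}

/-- A source has no in-neighbours. -/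
def IsSource (x : V) : Prop := D.inNbr x = ∅

/-- The edge ideal `I(D)`, generated by `x_i x_j ^ w(x_j)` for the oriented edges `(x_i, x_j)`. -/
noncomputable def edgeIdeal (K : Type*) [Field K] : Ideal (MvPolynomial V K) :=
  Ideal.span {f | ∃ x y, D.arc x y ∧
    f = MvPolynomial.X x * MvPolynomial.X y ^ D.weight y}

/-- The ⋆-property of an induced 5-cycle with vertex set `A`. The `z` that are quantified over are
the labellings `(a', a, b, b', c, a')` of the cycle, with `a' = z 0`, `a = z 1`, `b = z 2`,
`b' = z 3`, `c = z 4`; the labelling is determined by the edge `(a, b)`. -/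
def HasStarProperty (A : Set V) : Prop :=
  ∀ z : SimpleGraph.cycleGraph 5 ↪g D.graph, Set.range z = A →
    D.arc (z 1) (z 2) → z 1 ∈ D.plus →
      (D.arc (z 0) (z 1) ∧ D.weight (z 0) = 1) ∧
      (D.inNbr (z 1) ⊆ D.nbr (z 4) ∧ D.inNbr (z 1) ∩ D.plus ⊆ D.inNbr (z 4)) ∧
      (D.nbr (z 3) ⊆ D.nbr (z 0) ∪ D.outNbr (z 1) ∧
        D.inNbr (z 3) ∩ D.plus ⊆ D.inNbr (z 0))

/-- A weighted oriented subgraph of `D`; its weights are those of `D`. -/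
structure Sub where
  verts : Set V
  arc : V → V → Prop
  arc_le : ∀ x y, arc x y → D.arc x y
  left_mem : ∀ x y, arc x y → x ∈ verts
  right_mem : ∀ x y, arc x y → y ∈ verts

/-- The weighted oriented subgraph of `D` induced by a set of vertices. -/
def induce (A : Set V) : D.Sub where
  verts := A
  arc x y := D.arc x y ∧ x ∈ A ∧ y ∈ A
  arc_le _ _ h := h.1
  left_mem _ _ h := h.2.1
  right_mem _ _ h := h.2.2

variable {D}

namespace Sub

/-- The underlying graph of a subgraph, as a graph on `V` (the vertices of `V` outside the
subgraph are isolated in it). -/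
def under (H : D.Sub) : SimpleGraph V where
  Adj x y := H.arc x y ∨ H.arc y x
  symm := ⟨fun _ _ h => h.symm⟩
  loopless := ⟨fun x h =>
    have h' : H.arc x x := h.elim id id
    D.asymm x x (H.arc_le x x h') (H.arc_le x x h')⟩

/-- The degree of a vertex in a subgraph (the vertex set is finite in all uses). -/
noncomputable def deg (H : D.Sub) (x : V) : ℕ := (H.under.neighborSet x).ncard

/-- A walk in the underlying graph that follows the directions of the edges. -/
def IsOriented (H : D.Sub) {x y : V} (p : H.under.Walk x y) : Prop :=
  ∀ d ∈ p.darts, H.arc d.fst d.snd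

/-- There is an oriented path from `x` to `y` in `H`. -/
def HasOrientedPath (H : D.Sub) (x y : V) : Prop :=
  ∃ p : H.under.Walk x y, p.IsPath ∧ H.IsOriented p

/-- Unicycle oriented graphs: there is exactly one cycle `C`, it is an oriented cycle, every other
vertex is reached from `C` by an oriented path, and vertices of weight one have degree one.
Cycles are compared by their edge sets, since one cycle is traversed by several closed walks. -/
def IsUnicycle (B : D.Sub) : Prop :=
  (∃ (u : V) (C : B.under.Walk u u), C.IsCycle ∧
    (∀ (u' : V) (C' : B.under.Walk u' u'), C'.IsCycle → ∀ e, e ∈ C'.edges ↔ e ∈ C.edges) ∧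
    B.IsOriented C ∧
    ∀ y ∈ B.verts, y ∉ C.support → ∃ x ∈ C.support, B.HasOrientedPath x y) ∧
  ∀ x ∈ B.verts, D.weight x = 1 → B.deg x = 1

/-- Root oriented trees `T` with parent `v`. -/
def IsROT (T : D.Sub) (v : V) : Prop :=
  v ∈ T.verts ∧ T.under.IsAcyclic ∧
  (∀ x ∈ T.verts, x ≠ v → T.HasOrientedPath v x) ∧
  ∀ x ∈ T.verts, D.weight x = 1 → (T.deg x = 1 ∧ x ≠ v) ∨ (T.verts = {v} ∧ x = v)

/-- ⋆-semi-forests of `D`. -/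
def IsStarSemiForest (H : D.Sub) : Prop :=
  ∃ (r s : ℕ) (T : Fin r → D.Sub) (v : Fin r → V) (B : Fin s → D.Sub),
    (∀ i, (T i).IsROT (v i)) ∧ (∀ j, (B j).IsUnicycle) ∧
    -- `H` is the union of the `T i` and the `B j`
    H.verts = (⋃ i, (T i).verts) ∪ (⋃ j, (B j).verts) ∧
    (∀ x y, H.arc x y ↔ (∃ i, (T i).arc x y) ∨ (∃ j, (B j).arc x y)) ∧
    -- (i) their vertex sets are pairwise disjoint
    (∀ i i', i ≠ i' → Disjoint (T i).verts (T i').verts) ∧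
    (∀ j j', j ≠ j' → Disjoint (B j).verts (B j').verts) ∧
    (∀ i j, Disjoint (T i).verts (B j).verts) ∧
    -- (ii) the vertices `w i`, not necessarily distinct
    ∃ w : Fin r → V, (∀ i, w i ∉ H.verts ∧ w i ∈ D.nbr (v i)) ∧
      -- (iii) a partition of `W = {w i}` into two sets, possibly empty
      ∃ W₁ W₂ : Set V, W₁ ∪ W₂ = Set.range w ∧ Disjoint W₁ W₂ ∧
        D.graph.IsIndepSet W₁ ∧ W₂ ⊆ D.plus ∧ (∀ i, w i ∈ W₂ → D.arc (w i) (v i)) ∧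
        ∀ x ∈ W₂ ∪ ({x | x ∈ H.verts ∧ 2 ≤ H.deg x} ∪ {x | ∃ i, x = v i ∧ H.deg (v i) = 1}),
          Disjoint (D.outNbr x) W₁

/-- `K` has a generating ⋆-semi-forest. -/
def HasGeneratingStarSemiForest (K : D.Sub) : Prop :=
  ∃ H : D.Sub, H.IsStarSemiForest ∧ K.verts = H.verts

end Sub

end WOGraph

/-!
The associated primes of `I(D)` are generated by the strong vertex covers of `D`, so `I(D)` is
unmixed if and only if all strong vertex covers have the same cardinality. A vertex cover omits at
most one vertex of a simplex or of an edge and at most two vertices of a 5-cycle. Since the parts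
of an SCQ graph partition its vertex set, a cover attaining all these bounds has the least possible
cardinality, and a minimal cover, which is strong, attains them. Hence `I(D)` is unmixed if and
only if every strong vertex cover omits two vertices of each basic 5-cycle and one vertex of each
simplex and of each edge of `Q`. For one part at a time, these three requirements are the conditions
of the theorem; for simplexes, the witnesses of strongness attach every vertex of a part contained
in a strong cover to an in-neighbour, and the resulting arcs form a star-semi-forest.
-/

/-! ### Monomial ideals -/

section MonomialIdeals

open MvPolynomial

variable {σ R : Type*} [CommRing R] {s : Set (σ →₀ ℕ)} {hs : IsUpperSet s}
  {p : Ideal (MvPolynomial σ R)}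

theorem mem_restrictSupportIdeal_iff {f : MvPolynomial σ R} :
    f ∈ restrictSupportIdeal R s hs ↔ ∀ u ∈ f.support, u ∈ s :=
  Iff.rfl

theorem mem_support_mul_monomial_one_iff {f : MvPolynomial σ R} {u w : σ →₀ ℕ} :
    w ∈ (f * monomial u 1).support ↔ ∃ v ∈ f.support, v + u = w := by
  rw [mem_support_iff, coeff_mul_monomial']
  constructor
  · intro h
    split_ifs at h with hle
    · exact ⟨w - u, by simpa using h, tsub_add_cancel_of_le hle⟩
    · exact absurd rfl h
  · rintro ⟨v, hv, rfl⟩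
    simpa using hv

theorem mul_monomial_one_mem_restrictSupportIdeal_iff {f : MvPolynomial σ R} {u : σ →₀ ℕ} :
    f * monomial u 1 ∈ restrictSupportIdeal R s hs ↔ ∀ v ∈ f.support, v + u ∈ s := by
  simp only [mem_restrictSupportIdeal_iff, mem_support_mul_monomial_one_iff, forall_exists_index,
    and_imp, forall_apply_eq_imp_iff₂]

theorem mem_of_forall_monomial_one_mem {f : MvPolynomial σ R}
    (h : ∀ v ∈ f.support, monomial v 1 ∈ p) : f ∈ p := by
  rw [f.as_sum]
  refine Ideal.sum_mem _ fun v hv => ?_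
  rw [← mul_one (coeff v f), ← C_mul_monomial]
  exact p.mul_mem_left _ (h v hv)

theorem mem_colon_bot_mk_iff {A : Type*} [CommRing A] {I : Ideal A} {a b : A} :
    b ∈ (⊥ : Submodule A (A ⧸ I)).colon {Ideal.Quotient.mk I a} ↔ b * a ∈ I := by
  rw [Submodule.mem_colon_singleton, Submodule.mem_bot, ← Ideal.Quotient.eq_zero_iff_mem]
  rfl

theorem monomial_one_mem_iff_of_isPrime (hp : p.IsPrime) {v : σ →₀ ℕ} :
    monomial v 1 ∈ p ↔ ∃ x, X x ∈ p ∧ v x ≠ 0 := by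
  rw [monomial_eq, C_1, one_mul, Finsupp.prod, hp.prod_mem_iff]
  constructor
  · rintro ⟨x, hx, hmem⟩
    exact ⟨x, hp.mem_of_pow_mem _ hmem, Finsupp.mem_support_iff.1 hx⟩
  · rintro ⟨x, hmem, hx⟩
    exact ⟨x, Finsupp.mem_support_iff.2 hx, Ideal.pow_mem_of_mem _ hmem _ (Nat.pos_of_ne_zero hx)⟩

theorem exists_colon_support_stable (hp : p.IsPrime) {f : MvPolynomial σ R}
    (hf : ∀ g, g ∈ p ↔ g * f ∈ restrictSupportIdeal R s hs) :
    ∃ f : MvPolynomial σ R, (∀ g, g ∈ p ↔ g * f ∈ restrictSupportIdeal R s hs) ∧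
      ∀ u ∈ f.support, u ∉ s → ∀ v, monomial v 1 ∉ p → v + u ∉ s := by
  -- The new `f` is the product of the old one with all the monomials outside of `p` which move a
  -- term of the old one into the ideal.
  have hshift (u : σ →₀ ℕ) : ∃ m, monomial m 1 ∉ p ∧
      (m + u ∈ s ∨ ∀ v, monomial v 1 ∉ p → v + u ∉ s) := by
    by_cases h : ∃ m, monomial m 1 ∉ p ∧ m + u ∈ s
    · exact h.imp fun m hm => ⟨hm.1, Or.inl hm.2⟩
    · exact ⟨0, hp.one_notMem, Or.inr fun v hv hvu => h ⟨v, hv, hvu⟩⟩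
  choose m hmp hm using hshift
  have hmul {v w : σ →₀ ℕ} (hv : monomial v 1 ∉ p) (hw : monomial w 1 ∉ p) :
      monomial (v + w) (1 : R) ∉ p := by
    rw [← one_mul (1 : R), ← monomial_mul]
    exact hp.mul_notMem hv hw
  have hsum : monomial (∑ u ∈ f.support, m u) (1 : R) ∉ p := by
    rw [monomial_sum_one, hp.prod_mem_iff]
    exact fun ⟨u, _, hu⟩ => hmp u hu
  refine ⟨f * monomial (∑ u ∈ f.support, m u) 1, fun g => ?_, fun w hw hws v hv hvw => ?_⟩
  · rw [← mul_assoc, mul_right_comm, ← hf]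
    exact ⟨fun h => p.mul_mem_right _ h, fun h => (hp.mem_or_mem h).resolve_right hsum⟩
  · obtain ⟨u, hu, rfl⟩ := mem_support_mul_monomial_one_iff.1 hw
    rcases hm u with hmu | hmu
    · refine hws (hs ?_ hmu)
      rw [add_comm u]
      exact add_le_add_left (Finset.single_le_sum (f := m) (fun _ _ => zero_le) hu) u
    · refine hmu _ (hmul hv hsum) ?_
      rwa [add_assoc, add_comm _ u]

theorem exists_add_mem_of_support_mul_subset [IsDomain R] {f g : MvPolynomial σ R}
    {P Q : Set (σ →₀ ℕ)} (hfg : ∀ u ∈ (f * g).support, u ∈ s)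
    (hP : ∃ v ∈ f.support, v ∈ P) (hQ : ∃ w ∈ g.support, w ∈ Q)
    (hPQ : ∀ v ∈ f.support, ∀ w ∈ g.support, v + w ∉ s → v ∈ P ∧ w ∈ Q) :
    ∃ v ∈ f.support, v ∈ P ∧ ∃ w ∈ g.support, w ∈ Q ∧ v + w ∈ s := by
  classical
  -- A product of a term of `f` in `P` and a term of `g` in `Q` which is attained only once among
  -- such products is a term of `f * g`, unless its exponent lies in `s` anyway.
  obtain ⟨v, hv, w, hw, huniq⟩ := UniqueSums.uniqueAdd_of_nonempty
    (A := {v ∈ f.support | v ∈ P}) (B := {w ∈ g.support | w ∈ Q})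
    (hP.imp fun _ h => Finset.mem_filter.2 h) (hQ.imp fun _ h => Finset.mem_filter.2 h)
  rw [Finset.mem_filter] at hv hw
  refine ⟨v, hv.1, hv.2, w, hw.1, hw.2, ?_⟩
  by_contra hvw
  have hcoeff : coeff (v + w) (f * g) = coeff v f * coeff w g := by
    rw [coeff_mul]
    refine Finset.sum_eq_single (v, w) (fun b hb hne => ?_) fun h => ?_
    · rw [Finset.HasAntidiagonal.mem_antidiagonal] at hb
      by_contra h
      have hbf := mem_support_iff.2 (left_ne_zero_of_mul h)
      have hbg := mem_support_iff.2 (right_ne_zero_of_mul h)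
      obtain ⟨hbP, hbQ⟩ := hPQ _ hbf _ hbg (hb ▸ hvw)
      obtain ⟨h₁, h₂⟩ := huniq (Finset.mem_filter.2 ⟨hbf, hbP⟩) (Finset.mem_filter.2 ⟨hbg, hbQ⟩) hb
      exact hne (Prod.ext h₁ h₂)
    · simp at h
  refine hvw (hfg _ (mem_support_iff.2 ?_))
  rw [hcoeff]
  exact mul_ne_zero (mem_support_iff.1 hv.1) (mem_support_iff.1 hw.1)

theorem exists_mem_iff_forall_add_mem [IsDomain R] (hp : p.IsPrime) {f : MvPolynomial σ R}
    (hf : ∀ g, g ∈ p ↔ g * f ∈ restrictSupportIdeal R s hs) :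
    ∃ u, ∀ g, g ∈ p ↔ ∀ v ∈ g.support, v + u ∈ s := by
  obtain ⟨f, hf, hstable⟩ := exists_colon_support_stable hp hf
  obtain ⟨u, hu, hus⟩ : ∃ u ∈ f.support, u ∉ s := by
    by_contra! h
    exact hp.one_notMem ((hf 1).2 (by rwa [one_mul, mem_restrictSupportIdeal_iff]))
  have hadd {v w : σ →₀ ℕ} (hv : monomial v 1 ∈ p) (hw : w ∈ f.support) : v + w ∈ s := by
    refine mem_restrictSupportIdeal_iff.1 ((hf _).1 hv) _ ?_
    rw [mul_comm, add_comm]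
    exact mem_support_mul_monomial_one_iff.2 ⟨w, hw, rfl⟩
  have hmon (v : σ →₀ ℕ) : monomial v 1 ∈ p ↔ v + u ∈ s :=
    ⟨fun hv => hadd hv hu, fun h => by_contra fun hv => hstable u hu hus v hv h⟩
  refine ⟨u, fun g => ?_⟩
  simp_rw [← hmon]
  refine ⟨fun hg => ?_, mem_of_forall_monomial_one_mem⟩
  by_contra! h
  obtain ⟨v, _, hvp, w, hw, hws, hvw⟩ := exists_add_mem_of_support_mul_subset
    (P := {v | monomial v 1 ∉ p}) (Q := sᶜ) ((hf g).1 hg) h ⟨u, hu, hus⟩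
    fun _ _ _ hw hvw => ⟨fun hv => hvw (hadd hv hw), fun hw => hvw (hs le_add_self hw)⟩
  exact hstable w hw hws v hvp hvw

theorem isPrime_span_X_image [IsDomain R] (C : Set σ) :
    (Ideal.span (X '' C : Set (MvPolynomial σ R))).IsPrime := by
  classical
  let φ : MvPolynomial σ R →ₐ[R] MvPolynomial σ R := aeval fun x => if x ∈ C then 0 else X x
  suffices h : Ideal.span (X '' C) = RingHom.ker φ from h ▸ RingHom.ker_isPrime _
  refine le_antisymm ?_ fun f hf => ?_
  · rw [Ideal.span_le]
    rintro _ ⟨x, hx, rfl⟩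
    simp [φ, RingHom.mem_ker, hx]
  · have hmod : (Ideal.Quotient.mkₐ R (Ideal.span (X '' C))).comp φ = Ideal.Quotient.mkₐ R _ := by
      ext x
      by_cases hx : x ∈ C
      · simpa [φ, hx] using (Ideal.Quotient.eq_zero_iff_mem.2
          (Ideal.subset_span (Set.mem_image_of_mem X hx))).symm
      · simp [φ, hx]
    rw [← Ideal.Quotient.eq_zero_iff_mem]
    have := DFunLike.congr_fun hmod f
    rwa [AlgHom.comp_apply, (RingHom.mem_ker).1 hf, map_zero, eq_comm] at this

theorem height_span_X_image {K : Type*} [Field K] [Finite σ] (C : Set σ) :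
    (Ideal.span (X '' C : Set (MvPolynomial σ K))).height = C.ncard := by
  have hprime := isPrime_span_X_image (R := K) (σ := σ)
  apply le_antisymm
  · refine (Ideal.height_le_card_of_mem_minimalPrimes_span (Set.toFinite (X '' C)) ?_).trans ?_
    · rw [Ideal.minimalPrimes_eq_subsingleton_self, Set.mem_singleton_iff]
    · exact_mod_cast Set.ncard_image_le (Set.toFinite C)
  · induction C, Set.toFinite C using Set.Finite.induction_on with
    | empty => simp
    | @insert x C hx _ ih =>
      have hlt : Ideal.span (X '' C : Set (MvPolynomial σ K)) < Ideal.span (X '' insert x C) := by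
        refine (Ideal.span_mono (Set.image_mono (Set.subset_insert _ _))).lt_of_not_ge fun h => ?_
        have hX := h (Ideal.subset_span (Set.mem_image_of_mem X (Set.mem_insert x C)))
        rw [mem_ideal_span_X_image, support_X] at hX
        obtain ⟨y, hy, hyx⟩ := hX _ (Finset.mem_singleton_self _)
        exact hx ((Finsupp.single_apply_ne_zero.1 hyx).1 ▸ hy)
      rw [Set.ncard_insert_of_notMem hx]
      push_cast
      exact (add_le_add_left ih 1).trans (Ideal.height_add_one_le_of_lt_of_isPrime hlt)

theorem mem_associatedPrimes_restrictSupportIdeal_iff [IsDomain R] [IsNoetherianRing R] [Finite σ] :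
    p ∈ associatedPrimes (MvPolynomial σ R) (MvPolynomial σ R ⧸ restrictSupportIdeal R s hs) ↔
      ∃ (C : Set σ) (u : σ →₀ ℕ), p = Ideal.span (X '' C) ∧
        ∀ v, v + u ∈ s ↔ ∃ x ∈ C, v x ≠ 0 := by
  rw [AssociatedPrimes.mem_iff, isAssociatedPrime_iff]
  constructor
  · rintro ⟨hp, q, hq⟩
    obtain ⟨f, rfl⟩ := Ideal.Quotient.mk_surjective q
    obtain ⟨u, hu⟩ := exists_mem_iff_forall_add_mem hp (f := f)
      (fun g => by rw [hq, mem_colon_bot_mk_iff])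
    have hC (v : σ →₀ ℕ) : v + u ∈ s ↔ ∃ x ∈ {x | X x ∈ p}, v x ≠ 0 := by
      classical
      rw [← (by simp [hu, support_monomial] : monomial v 1 ∈ p ↔ v + u ∈ s)]
      exact monomial_one_mem_iff_of_isPrime hp
    refine ⟨{x | X x ∈ p}, u, ?_, hC⟩
    ext g
    simp only [hu g, mem_ideal_span_X_image, hC]
  · rintro ⟨C, u, rfl, hu⟩
    refine ⟨isPrime_span_X_image C, Ideal.Quotient.mk _ (monomial u 1), ?_⟩
    ext g
    simp only [mem_colon_bot_mk_iff, mul_monomial_one_mem_restrictSupportIdeal_iff,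
      mem_ideal_span_X_image, hu]

end MonomialIdeals

/-! ### Strong vertex covers -/

namespace WOGraph

variable {V : Type*} {D : WOGraph V}

theorem arc_ne {x y : V} (h : D.arc x y) : x ≠ y := by
  rintro rfl
  exact D.asymm _ _ h h

theorem adj_of_arc {x y : V} (h : D.arc x y) : D.graph.Adj x y :=
  (D.adj_iff x y).2 (Or.inl h)

theorem mem_nbr_iff {x y : V} : y ∈ D.nbr x ↔ D.graph.Adj x y :=
  (D.adj_iff x y).symm

theorem nbr_eq_neighborSet (x : V) : D.nbr x = D.graph.neighborSet x :=
  Set.ext fun _ => mem_nbr_iff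

variable (D) in
/-- The exponents of the monomials in the edge ideal. -/
def exponents : Set (V →₀ ℕ) := {u | ∃ x y, D.arc x y ∧ 1 ≤ u x ∧ D.weight y ≤ u y}

variable (D) in
theorem isUpperSet_exponents : IsUpperSet D.exponents := fun _ _ hle ⟨x, y, h, hx, hy⟩ =>
  ⟨x, y, h, hx.trans (hle x), hy.trans (hle y)⟩

theorem mem_exponents_iff_exists_le {u : V →₀ ℕ} :
    u ∈ D.exponents ↔
      ∃ x y, D.arc x y ∧ Finsupp.single x 1 + Finsupp.single y (D.weight y) ≤ u := by
  classical
  refine exists₂_congr fun x y => and_congr_right fun h => ?_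
  refine ⟨fun ⟨hx, hy⟩ z => ?_, fun hle => ?_⟩
  · by_cases hzx : z = x
    · subst hzx
      simpa [Finsupp.single_apply, arc_ne h, (arc_ne h).symm] using hx
    · by_cases hzy : z = y
      · subst hzy
        simpa [Finsupp.single_apply, Ne.symm hzx] using hy
      · simp [Ne.symm hzx, Ne.symm hzy]
  · have hx := hle x
    have hy := hle y
    simp only [Finsupp.add_apply, Finsupp.single_eq_same] at hx hy
    exact ⟨le_of_add_le_left hx, le_of_add_le_right hy⟩

theorem edgeIdeal_eq_restrictSupportIdeal (K : Type*) [Field K] :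
    D.edgeIdeal K = MvPolynomial.restrictSupportIdeal K D.exponents D.isUpperSet_exponents := by
  have hspan : D.edgeIdeal K = Ideal.span ((fun u => MvPolynomial.monomial u (1 : K)) ''
      {u | ∃ x y, D.arc x y ∧ u = Finsupp.single x 1 + Finsupp.single y (D.weight y)}) := by
    have hmonomial (x y : V) : (MvPolynomial.X x * MvPolynomial.X y ^ D.weight y) =
        MvPolynomial.monomial (Finsupp.single x 1 + Finsupp.single y (D.weight y)) (1 : K) := by
      rw [MvPolynomial.X_pow_eq_monomial, MvPolynomial.X, MvPolynomial.monomial_mul, one_mul]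
    rw [edgeIdeal]
    congr 1
    ext f
    simp only [hmonomial]
    constructor
    · rintro ⟨x, y, h, rfl⟩
      exact ⟨_, ⟨x, y, h, rfl⟩, rfl⟩
    · rintro ⟨_, ⟨x, y, h, rfl⟩, rfl⟩
      exact ⟨x, y, h, rfl⟩
  ext f
  rw [hspan, MvPolynomial.mem_ideal_span_monomial_image, mem_restrictSupportIdeal_iff]
  refine forall₂_congr fun u _ => ?_
  rw [mem_exponents_iff_exists_le]
  constructor
  · rintro ⟨_, ⟨x, y, h, rfl⟩, hle⟩
    exact ⟨x, y, h, hle⟩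
  · rintro ⟨x, y, h, hle⟩
    exact ⟨_, ⟨x, y, h, rfl⟩, hle⟩

variable (D) in
/-- Strong vertex covers, the sets of variables that generate the associated primes of the edge
ideal. Minimal vertex covers are strong, as no vertex of theirs has all its neighbours in the
cover. -/
def IsStrong (C : Set V) : Prop :=
  D.graph.IsVertexCover C ∧
    ∀ x ∈ C, D.nbr x ⊆ C → ∃ y ∈ D.plus, D.arc y x ∧ D.outNbr y ⊆ C

section Colon

variable {C : Set V} {u : V →₀ ℕ}

theorem exists_arc_of_forall_add_mem_exponents_iff
    (h : ∀ v, v + u ∈ D.exponents ↔ ∃ x ∈ C, v x ≠ 0) {x : V} (hx : x ∈ C) :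
    (D.weight x = u x + 1 ∧ ∃ y, D.arc y x ∧ 1 ≤ u y) ∨
      (u x = 0 ∧ ∃ y, D.arc x y ∧ D.weight y ≤ u y) := by
  classical
  have hu : u ∉ D.exponents := fun hu => by
    obtain ⟨y, _, hy⟩ := (h 0).1 (by rwa [zero_add])
    exact hy rfl
  obtain ⟨y, z, hyz, hy, hz⟩ := (h (Finsupp.single x 1)).2 ⟨x, hx, by simp⟩
  have hne := arc_ne hyz
  have hno : ¬ (1 ≤ u y ∧ D.weight z ≤ u z) := fun h' => hu ⟨y, z, hyz, h'⟩
  simp only [Finsupp.add_apply, Finsupp.single_apply] at hy hz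
  by_cases hxy : x = y
  · subst hxy
    rw [if_neg hne] at hz
    exact Or.inr ⟨by omega, z, hyz, by omega⟩
  · rw [if_neg hxy] at hy
    by_cases hxz : x = z
    · subst hxz
      rw [if_pos rfl] at hz
      exact Or.inl ⟨by omega, y, hyz, by omega⟩
    · rw [if_neg hxz] at hz
      omega

theorem isVertexCover_of_forall_add_mem_exponents_iff
    (h : ∀ v, v + u ∈ D.exponents ↔ ∃ x ∈ C, v x ≠ 0) : D.graph.IsVertexCover C := by
  classical
  have hcover {x y : V} (hxy : D.arc x y) : x ∈ C ∨ y ∈ C := by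
    obtain ⟨z, hz, hz'⟩ := (h (Finsupp.single x 1 + Finsupp.single y (D.weight y))).1
      (D.isUpperSet_exponents le_self_add (mem_exponents_iff_exists_le.2 ⟨x, y, hxy, le_rfl⟩))
    simp only [Finsupp.add_apply, Finsupp.single_apply] at hz'
    grind
  intro x y hxy
  exact ((D.adj_iff x y).1 hxy).elim hcover fun h => (hcover h).symm

theorem isStrong_of_forall_add_mem_exponents_iff
    (h : ∀ v, v + u ∈ D.exponents ↔ ∃ x ∈ C, v x ≠ 0) : D.IsStrong C := by
  classical
  have hlt : ∀ x ∈ C, u x < D.weight x := fun x hx => by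
    have := D.weight_pos x
    rcases exists_arc_of_forall_add_mem_exponents_iff h hx with ⟨hw, _⟩ | ⟨h0, _⟩ <;> omega
  refine ⟨isVertexCover_of_forall_add_mem_exponents_iff h, fun x hx hN => ?_⟩
  rcases exists_arc_of_forall_add_mem_exponents_iff h hx with ⟨_, y, hyx, hy⟩ | ⟨_, y, hxy, hy⟩
  · refine ⟨y, hy.trans_lt (hlt y (hN (Or.inr hyx))), hyx, fun z hz => ?_⟩
    obtain ⟨z', hz', hne⟩ := (h (Finsupp.single z (D.weight z))).1
      ⟨y, z, hz, by simp only [Finsupp.add_apply]; omega, by simp⟩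
    exact (Finsupp.single_apply_ne_zero.1 hne).1 ▸ hz'
  · exact absurd hy (hlt y (hN (Or.inl hxy))).not_ge

open Classical in
/-- An exponent `u` for which the colon ideal of the edge ideal by `X ^ u` is generated by the
variables in `C`, if `C` is a strong vertex cover. -/
noncomputable def colonExponent (D : WOGraph V) (C : Set V) (x : V) : ℕ :=
  if x ∈ C then if D.outNbr x ⊆ C then D.weight x - 1 else 0 else D.weight x

theorem colonExponent_lt_weight {x : V} (hx : x ∈ C) : D.colonExponent C x < D.weight x := by
  have := D.weight_pos x
  rw [colonExponent, if_pos hx]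
  split_ifs <;> omega

theorem IsStrong.exists_arc_one_le_colonExponent (hC : D.IsStrong C) {x : V} (hx : x ∈ C)
    (hout : D.outNbr x ⊆ C) : ∃ y, D.arc y x ∧ 1 ≤ D.colonExponent C y := by
  by_cases hN : D.nbr x ⊆ C
  · obtain ⟨y, hy, hyx, hyC⟩ := hC.2 x hx hN
    refine ⟨y, hyx, ?_⟩
    rw [colonExponent, if_pos (hN (Or.inr hyx)), if_pos hyC]
    exact Nat.le_sub_one_of_lt hy
  · obtain ⟨y, hy, hyC⟩ := Set.not_subset.1 hN
    refine ⟨y, hy.resolve_left fun h => hyC (hout h), ?_⟩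
    rw [colonExponent, if_neg hyC]
    exact D.weight_pos y

theorem IsStrong.forall_add_mem_exponents_iff (hC : D.IsStrong C)
    (hu : ⇑u = D.colonExponent C) (v : V →₀ ℕ) :
    v + u ∈ D.exponents ↔ ∃ x ∈ C, v x ≠ 0 := by
  constructor
  · rintro ⟨x, y, hxy, hx, hy⟩
    rw [Finsupp.add_apply, hu] at hx hy
    by_contra! hv
    by_cases hyC : y ∈ C
    · have := colonExponent_lt_weight (D := D) hyC
      rw [hv y hyC] at hy
      omega
    · have hxC := (hC.1 (adj_of_arc hxy)).resolve_right hyC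
      rw [hv x hxC, colonExponent, if_pos hxC, if_neg fun h => hyC (h hxy)] at hx
      omega
  · rintro ⟨x, hx, hv⟩
    by_cases hout : D.outNbr x ⊆ C
    · obtain ⟨y, hyx, hy⟩ := hC.exists_arc_one_le_colonExponent hx hout
      refine ⟨y, x, hyx, ?_, ?_⟩
      · rw [Finsupp.add_apply, hu]
        omega
      · rw [Finsupp.add_apply, hu, colonExponent, if_pos hx, if_pos hout]
        omega
    · obtain ⟨y, hxy, hyC⟩ := Set.not_subset.1 hout
      refine ⟨x, y, hxy, ?_, ?_⟩
      · rw [Finsupp.add_apply]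
        omega
      · rw [Finsupp.add_apply, hu, colonExponent, if_neg hyC]
        omega

end Colon

theorem mem_associatedPrimes_edgeIdeal_iff [Finite V] {K : Type*} [Field K]
    {p : Ideal (MvPolynomial V K)} :
    p ∈ associatedPrimes (MvPolynomial V K) (MvPolynomial V K ⧸ D.edgeIdeal K) ↔
      ∃ C, D.IsStrong C ∧ p = Ideal.span (MvPolynomial.X '' C) := by
  rw [edgeIdeal_eq_restrictSupportIdeal, mem_associatedPrimes_restrictSupportIdeal_iff]
  constructor
  · rintro ⟨C, u, hp, hu⟩
    exact ⟨C, isStrong_of_forall_add_mem_exponents_iff hu, hp⟩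
  · rintro ⟨C, hC, hp⟩
    exact ⟨C, Finsupp.equivFunOnFinite.symm (D.colonExponent C), hp,
      hC.forall_add_mem_exponents_iff rfl⟩

theorem isUnmixed_edgeIdeal_iff [Finite V] (K : Type*) [Field K] :
    IdealIsUnmixed (D.edgeIdeal K) ↔
      ∀ C C' : Set V, D.IsStrong C → D.IsStrong C' → C.ncard = C'.ncard := by
  constructor
  · intro h C C' hC hC'
    have := h _ (mem_associatedPrimes_edgeIdeal_iff.2 ⟨C, hC, rfl⟩) _
      (mem_associatedPrimes_edgeIdeal_iff.2 ⟨C', hC', rfl⟩)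
    rw [height_span_X_image, height_span_X_image] at this
    exact_mod_cast this
  · intro h p hp q hq
    obtain ⟨C, hC, rfl⟩ := mem_associatedPrimes_edgeIdeal_iff.1 hp
    obtain ⟨C', hC', rfl⟩ := mem_associatedPrimes_edgeIdeal_iff.1 hq
    rw [height_span_X_image, height_span_X_image, h C C' hC hC']

end WOGraph

theorem exists_isVertexCover_disjoint {V : Type*} {G : SimpleGraph V} {S B : Set V}
    (hS : G.IsIndepSet S) (hBS : Disjoint B S) :
    ∃ C, G.IsVertexCover C ∧ B ⊆ C ∧ Disjoint C S ∧ ∀ x ∈ C, G.neighborSet x ⊆ C → x ∈ B := by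
  have hchain : ∀ c ⊆ {C | G.IsVertexCover C ∧ B ⊆ C ∧ Disjoint C S}, IsChain (· ⊆ ·) c →
      c.Nonempty → ∃ L ∈ {C | G.IsVertexCover C ∧ B ⊆ C ∧ Disjoint C S}, ∀ C ∈ c, L ⊆ C := by
    intro c hc hchain hne
    refine ⟨⋂₀ c, ⟨fun x y hxy => ?_, Set.subset_sInter fun C hC => (hc hC).2.1, ?_⟩,
      fun C hC => Set.sInter_subset_of_mem hC⟩
    · by_contra! h
      obtain ⟨⟨C, hC, hxC⟩, C', hC', hyC'⟩ := h.imp (by simpa using ·) (by simpa using ·)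
      rcases hchain.total hC hC' with hle | hle
      · exact ((hc hC).1 hxy).elim hxC fun h => hyC' (hle h)
      · exact ((hc hC').1 hxy).elim (fun h => hxC (hle h)) hyC'
    · obtain ⟨C, hC⟩ := hne
      exact (hc hC).2.2.mono_left (Set.sInter_subset_of_mem hC)
  obtain ⟨C, -, hC⟩ := zorn_superset_nonempty _ hchain Sᶜ
    ⟨SimpleGraph.isVertexCover_compl.2 hS, Set.subset_compl_iff_disjoint_right.2 hBS,
      disjoint_compl_left⟩
  refine ⟨C, hC.prop.1, hC.prop.2.1, hC.prop.2.2, fun x hx hN => by_contra fun hxB => ?_⟩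
  have hdel : C \ {x} ∈ {C | G.IsVertexCover C ∧ B ⊆ C ∧ Disjoint C S} := by
    refine ⟨fun y z hyz => ?_, fun y hy => ⟨hC.prop.2.1 hy, ?_⟩,
      hC.prop.2.2.mono_left Set.sdiff_subset⟩
    · by_cases hy : y = x
      · exact Or.inr ⟨hN (hy ▸ hyz), hy ▸ hyz.ne'⟩
      · by_cases hz : z = x
        · exact Or.inl ⟨hN (hz ▸ hyz.symm), hy⟩
        · exact (hC.prop.1 hyz).imp (⟨·, hy⟩) (⟨·, hz⟩)
    · rintro rfl
      exact hxB hy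
  exact (hC.le_of_le hdel Set.sdiff_subset hx).2 rfl

theorem SCQ.PropertyP.neighborSet_subset_or {V : Type*} {G : SimpleGraph V} {b b' : V} {C : Set V}
    (hP : SCQ.PropertyP G s(b, b')) (hC : G.IsVertexCover C) :
    G.neighborSet b ⊆ C ∨ G.neighborSet b' ⊆ C := by
  by_contra! h
  obtain ⟨⟨a, ha, haC⟩, ⟨a', ha', haC'⟩⟩ := h.imp Set.not_subset.1 Set.not_subset.1
  exact (hC (hP a b a' b' rfl ha.symm ha'.symm)).elim haC haC'

namespace WOGraph

variable {V : Type*} {D : WOGraph V}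

theorem mem_nbr_comm {x y : V} : y ∈ D.nbr x ↔ x ∈ D.nbr y := by
  rw [mem_nbr_iff, mem_nbr_iff, SimpleGraph.adj_comm]

theorem nbr_subset_of_isVertexCover {C : Set V} (hC : D.graph.IsVertexCover C) {x : V}
    (hx : x ∉ C) : D.nbr x ⊆ C :=
  fun _ hy => (hC (mem_nbr_iff.1 hy)).resolve_left hx

theorem exists_isStrong {S A : Set V} (hS : D.graph.IsIndepSet S) (hA : A ⊆ D.plus)
    (hAS : ∀ a ∈ A, Disjoint (D.outNbr a) S) :
    ∃ C, D.IsStrong C ∧ (∀ s ∈ S, D.nbr s ⊆ C) ∧ ∀ a ∈ A, D.outNbr a ⊆ C := by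
  obtain ⟨C, hC, hAC, hCS, hmin⟩ := exists_isVertexCover_disjoint (B := ⋃ a ∈ A, D.outNbr a) hS
    (Set.disjoint_iUnion₂_left.2 hAS)
  rw [Set.iUnion₂_subset_iff] at hAC
  refine ⟨C, ⟨hC, fun x hx hN => ?_⟩,
    fun s hs => nbr_subset_of_isVertexCover hC (Set.disjoint_right.1 hCS hs), hAC⟩
  obtain ⟨a, ha, hax⟩ := Set.mem_iUnion₂.1 (hmin x hx (nbr_eq_neighborSet x ▸ hN))
  exact ⟨a, hA ha, hax, hAC a ha⟩

theorem IsStrong.notMem_or_notMem_of_propertyP {b b' : V} {C : Set V} (hC : D.IsStrong C)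
    (hP : SCQ.PropertyP D.graph s(b, b'))
    (hb : ∀ a ∈ D.plus, D.arc a b' → D.nbr b ⊆ D.outNbr a)
    (hb' : ∀ a ∈ D.plus, D.arc a b → D.nbr b' ⊆ D.outNbr a) : b ∉ C ∨ b' ∉ C := by
  by_contra! h
  wlog hN : D.nbr b ⊆ C generalizing b b'
  · exact this (Sym2.eq_swap ▸ hP) hb' hb h.symm
      (nbr_eq_neighborSet b' ▸ (hP.neighborSet_subset_or hC.1).resolve_left
        (nbr_eq_neighborSet b ▸ hN))
  obtain ⟨y, hy, hyb, hyC⟩ := hC.2 b h.1 hN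
  obtain ⟨y', hy', hyb', -⟩ := hC.2 b' h.2 ((hb' y hy hyb).trans hyC)
  exact D.asymm _ _ (hb y' hy' hyb' (Or.inr hyb)) (hb' y hy hyb (Or.inr hyb'))

theorem nbr_subset_outNbr_of_forall_isStrong {a b b' : V}
    (h : ∀ C, D.IsStrong C → b ∉ C ∨ b' ∉ C) (ha : a ∈ D.plus) (hab : D.arc a b') :
    D.nbr b ⊆ D.outNbr a := by
  intro c hc
  by_contra hca
  obtain ⟨C, hC, hS, hA⟩ := exists_isStrong (D := D) (S := {c}) (A := {a}) (by simp)
    (by simpa using ha) (by simpa using hca)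
  exact (h C hC).elim (· (hS c rfl (mem_nbr_comm.1 hc))) (· (hA a rfl hab))

end WOGraph

/-! ### Basic 5-cycles -/

namespace SCQ

open SimpleGraph

variable {V : Type*} {G : SimpleGraph V}

/-- The rotation of a cycle by `k` steps, used to relabel induced cycles. -/
def cycleRotation {n : ℕ} (k : Fin (n + 2)) : cycleGraph (n + 2) ≃g cycleGraph (n + 2) where
  toEquiv := Equiv.addRight k
  map_rel_iff' := by simp [cycleGraph_adj]

/-- The reflection of a cycle that exchanges `i` and `k - i`, used to relabel induced cycles. -/
def cycleReflection {n : ℕ} (k : Fin (n + 2)) : cycleGraph (n + 2) ≃g cycleGraph (n + 2) where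
  toEquiv := Equiv.subLeft k
  map_rel_iff' := by simp [cycleGraph_adj, or_comm]

theorem range_trans_embedding {W U : Type*} {H : SimpleGraph W} {H' : SimpleGraph U}
    (f : H' ≃g H) (z : H ↪g G) : Set.range (f.toEmbedding.trans z) = Set.range z :=
  EquivLike.range_comp z f

theorem three_le_deg_of_not_subset_range [Finite V] {z : cycleGraph 5 ↪g G} {i : Fin 5}
    (hi : ¬ G.neighborSet (z i) ⊆ Set.range z) : 3 ≤ deg G (z i) := by
  obtain ⟨d, hd, hdz⟩ := Set.not_subset.1 hi
  have hcard : (z '' (cycleGraph 5).neighborSet i).ncard = 2 := by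
    rw [Set.ncard_image_of_injective _ z.injective, Set.ncard_eq_toFinset_card']
    exact cycleGraph_degree_three_le
  have hsub : insert d (z '' (cycleGraph 5).neighborSet i) ⊆ G.neighborSet (z i) :=
    Set.insert_subset hd (Set.image_subset_iff.2 fun _ hj => z.map_adj_iff.2 hj)
  have hle := Set.ncard_le_ncard hsub
  rwa [Set.ncard_insert_of_notMem fun h => hdz (Set.image_subset_range _ _ h), hcard] at hle

theorem IsBasic.neighborSet_subset_range_or [Finite V] {z : cycleGraph 5 ↪g G}
    (hz : IsBasic G z) {i j : Fin 5} (hij : (cycleGraph 5).Adj i j) :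
    G.neighborSet (z i) ⊆ Set.range z ∨ G.neighborSet (z j) ⊆ Set.range z := by
  by_contra! h
  exact hz i j (z.map_adj_iff.2 hij)
    (h.imp three_le_deg_of_not_subset_range three_le_deg_of_not_subset_range)

theorem IsBasic.of_range_eq {z z' : cycleGraph 5 ↪g G} (hz : IsBasic G z)
    (h : Set.range z' = Set.range z) : IsBasic G z' := by
  intro i j
  obtain ⟨i', hi⟩ : z' i ∈ Set.range z := h ▸ Set.mem_range_self i
  obtain ⟨j', hj⟩ : z' j ∈ Set.range z := h ▸ Set.mem_range_self j
  rw [← hi, ← hj]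
  exact hz i' j'

theorem nontrivial_range_diff_iff {ι : Type*} [Nonempty ι] {z : ι → V}
    (hz : Function.Injective z) {C : Set V} :
    (Set.range z \ C).Nontrivial ↔ ∀ k, ∃ i ≠ k, z i ∉ C := by
  constructor
  · intro h k
    obtain ⟨_, ⟨⟨i, rfl⟩, hi⟩, hne⟩ := h.exists_ne (z k)
    exact ⟨i, fun h => hne (h ▸ rfl), hi⟩
  · intro h
    obtain ⟨i, -, hi⟩ := h (Classical.arbitrary ι)
    obtain ⟨j, hji, hj⟩ := h i
    exact ⟨z i, ⟨⟨i, rfl⟩, hi⟩, z j, ⟨⟨j, rfl⟩, hj⟩, fun h => hji (hz h).symm⟩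

theorem IsBasic.exists_relabelling [Finite V] {z : cycleGraph 5 ↪g G} (hz : IsBasic G z)
    {C : Set V} (hC : ¬ (Set.range z \ C).Nontrivial) :
    ∃ z' : cycleGraph 5 ↪g G, Set.range z' = Set.range z ∧ (∀ i ≠ 4, z' i ∈ C) ∧
      G.neighborSet (z' 1) ⊆ Set.range z := by
  rw [nontrivial_range_diff_iff z.injective] at hC
  push Not at hC
  obtain ⟨k, hk⟩ := hC
  let y := (cycleRotation (k + 1)).toEmbedding.trans z
  have hyz : Set.range y = Set.range z := range_trans_embedding _ z
  have hy : ∀ i ≠ 4, y i ∈ C := fun i hi =>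
    hk (i + (k + 1)) ((by decide : ∀ i k : Fin 5, i ≠ 4 → i + (k + 1) ≠ k) i k hi)
  rw [← hyz]
  rcases (hz.of_range_eq hyz).neighborSet_subset_range_or (i := 1) (j := 2) (by decide) with h | h
  · exact ⟨y, rfl, hy, h⟩
  · exact ⟨_, range_trans_embedding (cycleReflection 3) y,
      fun i hi => hy (3 - i) ((by decide : ∀ i : Fin 5, i ≠ 4 → 3 - i ≠ 4) i hi), h⟩

end SCQ

namespace WOGraph

open SimpleGraph SCQ

variable {V : Type*} {D : WOGraph V}

theorem mem_nbr_embedding {W : Type*} {H : SimpleGraph W} (z : H ↪g D.graph) {i j : W} :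
    z j ∈ D.nbr (z i) ↔ H.Adj i j :=
  mem_nbr_iff.trans z.map_adj_iff

theorem IsStrong.range_subset_of_arc {z : cycleGraph 5 ↪g D.graph} {C : Set V}
    (hC : D.IsStrong C) (hstar : D.HasStarProperty (Set.range z)) (h1 : z 1 ∈ C) (h3 : z 3 ∈ C)
    (harc : D.arc (z 1) (z 2)) (hplus : z 1 ∈ D.plus) (hout : D.outNbr (z 1) ⊆ C) :
    Set.range z ⊆ C := by
  obtain ⟨-, ⟨hin, hin'⟩, hnbr, hnbr'⟩ := hstar z rfl harc hplus
  have h0 : z 0 ∈ C := by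
    by_contra h0
    obtain ⟨y, hy, hy3, hyC⟩ := hC.2 (z 3) h3
      (hnbr.trans (Set.union_subset (nbr_subset_of_isVertexCover hC.1 h0) hout))
    exact h0 (hyC (hnbr' ⟨hy3, hy⟩))
  have h4 : z 4 ∈ C := by
    by_cases hN : D.nbr (z 1) ⊆ C
    · obtain ⟨y, hy, hy1, hyC⟩ := hC.2 (z 1) h1 hN
      exact hyC (hin' ⟨hy1, hy⟩)
    · obtain ⟨d, hd, hdC⟩ := Set.not_subset.1 hN
      have hd1 : D.arc d (z 1) := hd.resolve_left fun h => hdC (hout h)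
      exact nbr_subset_of_isVertexCover hC.1 hdC (mem_nbr_comm.1 (hin hd1))
  rintro _ ⟨i, rfl⟩
  fin_cases i
  exacts [h0, h1, hout harc, h3, h4]

theorem IsStrong.exists_mem_nbr_notMem_range {z : cycleGraph 5 ↪g D.graph} {C : Set V}
    (hC : D.IsStrong C) (hstar : D.HasStarProperty (Set.range z)) (hsub : Set.range z ⊆ C)
    (harc : D.arc (z 1) (z 2)) (hplus : z 1 ∈ D.plus) (hout : D.outNbr (z 1) ⊆ C) :
    ∃ d ∉ Set.range z, d ∈ D.nbr (z 0) ∧ d ∈ D.nbr (z 3) ∧ (D.arc d (z 3) ∨ d ∉ C) := by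
  obtain ⟨-, -, hnbr, hnbr'⟩ := hstar z rfl harc hplus
  by_cases hN : D.nbr (z 3) ⊆ C
  · obtain ⟨d, hd, hd3, -⟩ := hC.2 (z 3) (hsub ⟨3, rfl⟩) hN
    have hd0 : D.arc d (z 0) := hnbr' ⟨hd3, hd⟩
    refine ⟨d, ?_, Or.inr hd0, Or.inr hd3, Or.inl hd3⟩
    rintro ⟨i, rfl⟩
    obtain rfl : i = 4 :=
      (by decide : ∀ i, (cycleGraph 5).Adj 0 i → (cycleGraph 5).Adj 3 i → i = 4) i
        ((mem_nbr_embedding z).1 (Or.inr hd0)) ((mem_nbr_embedding z).1 (Or.inr hd3))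
    exact D.asymm _ _ (hstar _ (range_trans_embedding (cycleReflection 0) z) hd3 hd).1.1 hd0
  · obtain ⟨d, hd, hdC⟩ := Set.not_subset.1 hN
    exact ⟨d, fun h => hdC (hsub h), (hnbr hd).resolve_right fun h => hdC (hout h), hd, Or.inr hdC⟩

theorem IsStrong.not_range_subset_of_arc [Finite V] {z : cycleGraph 5 ↪g D.graph} {C : Set V}
    (hC : D.IsStrong C) (hz : IsBasic D.graph z) (hstar : D.HasStarProperty (Set.range z))
    (harc : D.arc (z 1) (z 2)) (hplus : z 1 ∈ D.plus) (hout : D.outNbr (z 1) ⊆ C) :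
    ¬ Set.range z ⊆ C := by
  intro hsub
  obtain ⟨d, hdz, hd0, hd3, hd3'⟩ := hC.exists_mem_nbr_notMem_range hstar hsub harc hplus hout
  have hnbr {i j : Fin 5} (hij : (cycleGraph 5).Adj i j) (hdi : d ∈ D.nbr (z i)) :
      D.nbr (z j) ⊆ Set.range z := by
    rw [nbr_eq_neighborSet] at hdi ⊢
    exact (hz.neighborSet_subset_range_or hij).resolve_left fun h => hdz (h hdi)
  have h4 : D.nbr (z 4) ⊆ Set.range z := hnbr (by decide) hd3
  obtain ⟨y, hy, hy4, hyC⟩ := hC.2 (z 4) (hsub ⟨4, rfl⟩) (h4.trans hsub)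
  obtain ⟨i, rfl⟩ := h4 (Or.inr hy4)
  have hi0 : i ≠ 0 := by
    rintro rfl
    exact hy.ne' (hstar z rfl harc hplus).1.2
  obtain rfl : i = 3 :=
    (by decide : ∀ i, (cycleGraph 5).Adj 4 i → i ≠ 0 → i = 3) i
      ((mem_nbr_embedding z).1 (Or.inr hy4)) hi0
  obtain ⟨-, ⟨hin, -⟩, -⟩ := hstar _ (range_trans_embedding (cycleRotation 2) z) hy4 hy
  have hd : D.arc d (z 3) :=
    hd3'.elim id fun hdC => hd3.resolve_left fun h => hdC (hyC h)
  exact hdz (hnbr (by decide) hd0 (hin hd : d ∈ D.nbr (z 1)))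

theorem IsStrong.nontrivial_range_diff [Finite V] {z : cycleGraph 5 ↪g D.graph} {C : Set V}
    (hC : D.IsStrong C) (hz : IsBasic D.graph z) (hstar : D.HasStarProperty (Set.range z)) :
    (Set.range z \ C).Nontrivial := by
  by_contra hnt
  obtain ⟨y, hyz, hyC, hy1⟩ := hz.exists_relabelling hnt
  have hfalse {x : cycleGraph 5 ↪g D.graph} (hx : Set.range x = Set.range y)
      (h1 : x 1 ∈ C) (h3 : x 3 ∈ C) (harc : D.arc (x 1) (x 2)) (hplus : x 1 ∈ D.plus)
      (hout : D.outNbr (x 1) ⊆ C) : False := by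
    have hstar' : D.HasStarProperty (Set.range x) := by rwa [hx, hyz]
    exact hC.not_range_subset_of_arc (hz.of_range_eq (hx.trans hyz)) hstar' harc hplus hout
      (hC.range_subset_of_arc hstar' h1 h3 harc hplus hout)
  have hnbr {v : V} (hv : v ∈ D.nbr (y 1)) : v = y 0 ∨ v = y 2 := by
    obtain ⟨i, rfl⟩ := hyz ▸ hy1 (mem_nbr_iff.1 hv)
    exact ((by decide : ∀ i, (cycleGraph 5).Adj 1 i → i = 0 ∨ i = 2) i
      ((mem_nbr_embedding y).1 hv)).imp (congrArg y) (congrArg y)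
  obtain ⟨w, hw, hw1, hwC⟩ := hC.2 (y 1) (hyC 1 (by decide)) fun v hv =>
    (hnbr hv).elim (· ▸ hyC 0 (by decide)) (· ▸ hyC 2 (by decide))
  rcases hnbr (Or.inr hw1) with rfl | rfl
  · exact hfalse (range_trans_embedding (cycleRotation 4) y) (hyC 0 (by decide))
      (hyC 2 (by decide)) hw1 hw hwC
  · exact hfalse (range_trans_embedding (cycleReflection 3) y) (hyC 2 (by decide))
      (hyC 0 (by decide)) hw1 hw hwC

theorem exists_arc_of_mem_plus (hsource : ∀ x, D.IsSource x → D.weight x = 1) {x : V}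
    (hx : x ∈ D.plus) : ∃ y, D.arc y x :=
  Set.nonempty_iff_ne_empty.2 fun h => hx.ne' (hsource x h)

theorem nbr_subset_nbr_union_outNbr_of_forall_isStrong {a u x : V} (ha : a ∈ D.plus)
    (hau : ¬ D.arc a u)
    (h : ∀ C, D.IsStrong C → D.nbr u ⊆ C → D.outNbr a ⊆ C → x ∉ C) :
    D.nbr x ⊆ D.nbr u ∪ D.outNbr a := by
  intro d hd
  by_contra! hdu
  rw [Set.mem_union, not_or] at hdu
  obtain ⟨C, hC, hS, hA⟩ := exists_isStrong (D := D) (S := {u, d}) (A := {a})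
    (by simpa [isIndepSet_iff, Set.pairwise_pair, ← mem_nbr_iff, mem_nbr_comm (x := d)] using
      fun _ => hdu.1)
    (by simpa using ha) (by rintro _ rfl; simpa [Set.disjoint_insert_right] using ⟨hau, hdu.2⟩)
  exact h C hC (hS u (by simp)) (hA a rfl) (hS d (by simp) (mem_nbr_comm.1 hd))

theorem inNbr_inter_plus_subset_inNbr_of_forall_isStrong {a u x : V} (ha : a ∈ D.plus)
    (hau : ¬ D.arc a u)
    (h : ∀ C, D.IsStrong C → D.nbr u ⊆ C → D.outNbr a ⊆ C → x ∉ C) :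
    D.inNbr x ∩ D.plus ⊆ D.inNbr u := by
  rintro d ⟨hdx, hd⟩
  by_contra hdu
  obtain ⟨C, hC, hS, hA⟩ := exists_isStrong (D := D) (S := {u}) (A := {a, d}) (by simp)
    (Set.insert_subset ha (by simpa using hd))
    (by rintro _ (rfl | rfl) <;> rwa [Set.disjoint_singleton_right])
  exact h C hC (hS u rfl) (hA a (by simp)) (hA d (by simp) hdx)

theorem arc_zero_one_of_forall_isStrong {z : cycleGraph 5 ↪g D.graph}
    (hsource : ∀ x, D.IsSource x → D.weight x = 1)
    (h : ∀ C, D.IsStrong C → (Set.range z \ C).Nontrivial)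
    (harc : D.arc (z 1) (z 2)) (hplus : z 1 ∈ D.plus) : D.arc (z 0) (z 1) := by
  by_contra h01
  have h10 : D.arc (z 1) (z 0) :=
    ((mem_nbr_embedding z).2 (by decide : (cycleGraph 5).Adj 1 0)).resolve_right h01
  obtain ⟨d, hd⟩ := exists_arc_of_mem_plus hsource hplus
  obtain ⟨C, hC, hS, hA⟩ := exists_isStrong (D := D) (S := {d}) (A := {z 1}) (by simp)
    (by simpa using hplus)
    (by rintro _ rfl; exact Set.disjoint_singleton_right.2 (D.asymm _ _ hd))
  have h1 : z 1 ∈ C := hS d rfl (Or.inl hd)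
  obtain ⟨k, hk⟩ : ∃ k : Fin 5, ∀ i ≠ k, i = 0 ∨ i = 1 ∨ i = 2 ∨ z i ∈ C := by
    rcases hC.1 (z.map_adj_iff.2 (by decide : (cycleGraph 5).Adj 3 4)) with h3 | h4
    · exact ⟨4, fun i hi => by fin_cases i <;> simp_all⟩
    · exact ⟨3, fun i hi => by fin_cases i <;> simp_all⟩
  obtain ⟨i, hik, hi⟩ := (nontrivial_range_diff_iff z.injective).1 (h C hC) k
  rcases hk i hik with rfl | rfl | rfl | h
  exacts [hi (hA _ rfl h10), hi h1, hi (hA _ rfl harc), hi h]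

theorem hasStarProperty_of_forall_isStrong {A : Set V}
    (hsource : ∀ x, D.IsSource x → D.weight x = 1)
    (h : ∀ C, D.IsStrong C → (A \ C).Nontrivial) : D.HasStarProperty A := by
  rintro z rfl h12 h1
  have hnot {C : Set V} (hC : D.IsStrong C) (k : Fin 5) : ¬ ∀ i ≠ k, z i ∈ C := by
    simpa using (nontrivial_range_diff_iff z.injective).1 (h C hC) k
  have hnbr {i j : Fin 5} (hij : (cycleGraph 5).Adj i j) : z j ∈ D.nbr (z i) :=
    (mem_nbr_embedding z).2 hij
  have h01 : D.arc (z 0) (z 1) := arc_zero_one_of_forall_isStrong hsource h h12 h1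
  have h14 : ¬ D.arc (z 1) (z 4) := fun h14 =>
    absurd ((mem_nbr_embedding z).1 (Or.inl h14)) (by decide)
  have hstar2 : ∀ C, D.IsStrong C → D.nbr (z 4) ⊆ C → D.outNbr (z 1) ⊆ C → z 1 ∉ C := by
    intro C hC h4 hout hz1
    refine hnot hC 4 fun i hi => ?_
    fin_cases i
    exacts [h4 (hnbr (by decide)), hz1, hout h12, h4 (hnbr (by decide)), (hi rfl).elim]
  have hstar3 : ∀ C, D.IsStrong C → D.nbr (z 0) ⊆ C → D.outNbr (z 1) ⊆ C → z 3 ∉ C := by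
    intro C hC h0 hout hz3
    refine hnot hC 0 fun i hi => ?_
    fin_cases i
    exacts [(hi rfl).elim, h0 (hnbr (by decide)), hout h12, hz3, h0 (hnbr (by decide))]
  have hin := inNbr_inter_plus_subset_inNbr_of_forall_isStrong h1 h14 hstar2
  refine ⟨⟨h01, ?_⟩, ⟨fun d hd => ?_, hin⟩,
    nbr_subset_nbr_union_outNbr_of_forall_isStrong h1 (D.asymm _ _ h01) hstar3,
    inNbr_inter_plus_subset_inNbr_of_forall_isStrong h1 (D.asymm _ _ h01) hstar3⟩
  · by_contra hw
    have h0 : z 0 ∈ D.plus := lt_of_le_of_ne (D.weight_pos _) (Ne.symm hw)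
    have h40 : D.arc (z 4) (z 0) := arc_zero_one_of_forall_isStrong
      (z := (cycleRotation 4).toEmbedding.trans z) hsource
      (by simpa only [range_trans_embedding] using h) h01 h0
    exact D.asymm _ _ h40 (hin ⟨h01, h0⟩)
  · exact (nbr_subset_nbr_union_outNbr_of_forall_isStrong h1 h14 hstar2 (Or.inr hd)).resolve_right
      (D.asymm _ _ hd)

theorem hasStarProperty_iff_forall_isStrong [Finite V]
    (hsource : ∀ x, D.IsSource x → D.weight x = 1) {A : Set V}
    (hA : A ∈ basicFiveCycles D.graph) :
    D.HasStarProperty A ↔ ∀ C, D.IsStrong C → (A \ C).Nontrivial := by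
  obtain ⟨z, hz, rfl⟩ := hA
  exact ⟨fun h C hC => hC.nontrivial_range_diff hz h, hasStarProperty_of_forall_isStrong hsource⟩

end WOGraph

/-! ### Counting along the partition -/

theorem sum_ncard_diff_add_ncard {V : Type*} [Finite V] {P : Set (Set V)} [Fintype P]
    (hP : Setoid.IsPartition P) (C : Set V) :
    ∑ A : P, (A.1 \ C).ncard + C.ncard = Nat.card V := by
  rw [← Set.ncard_compl_add_ncard C, hP.ncard_eq_finsum Cᶜ, finsum_eq_sum_of_fintype]
  simp only [Set.inter_comm, Set.sdiff_eq]

theorem ncard_le_ncard_of_isPartition {V : Type*} [Finite V] {P : Set (Set V)}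
    (hP : Setoid.IsPartition P) {C C' : Set V}
    (h : ∀ A ∈ P, (A \ C').ncard ≤ (A \ C).ncard) : C.ncard ≤ C'.ncard := by
  have := Fintype.ofFinite P
  have hC := sum_ncard_diff_add_ncard hP C
  have hC' := sum_ncard_diff_add_ncard hP C'
  have hle := Finset.sum_le_sum fun (A : P) (_ : A ∈ Finset.univ) => h A A.2
  omega

theorem ncard_diff_eq_of_ncard_eq {V : Type*} [Finite V] {P : Set (Set V)}
    (hP : Setoid.IsPartition P) {C C' : Set V} (h : ∀ A ∈ P, (A \ C').ncard ≤ (A \ C).ncard)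
    (hcard : C.ncard = C'.ncard) {A : Set V} (hA : A ∈ P) : (A \ C').ncard = (A \ C).ncard := by
  have := Fintype.ofFinite P
  have hC := sum_ncard_diff_add_ncard hP C
  have hC' := sum_ncard_diff_add_ncard hP C'
  exact (Finset.sum_eq_sum_iff_of_le fun (A : P) _ => h A A.2).1 (by omega) ⟨A, hA⟩
    (Finset.mem_univ _)

namespace SCQ

open SimpleGraph

variable {V : Type*} {G : SimpleGraph V} {Q : Set (Sym2 V)} {C C' : Set V}

theorem subsingleton_diff_of_isClique {A : Set V} (hA : G.IsClique A) (hC : G.IsVertexCover C) :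
    (A \ C).Subsingleton := by
  refine fun x hx y hy => by_contra fun hne => ?_
  exact (hC (hA hx.1 hy.1 hne)).elim hx.2 hy.2

theorem ncard_range_diff_le_two (z : cycleGraph 5 ↪g G) (hC : G.IsVertexCover C) :
    (Set.range z \ C).ncard ≤ 2 := by
  classical
  have hindep : ∀ s : Finset (Fin 5), (∀ i ∈ s, ∀ j ∈ s, ¬ (cycleGraph 5).Adj i j) →
      s.card ≤ 2 := by
    decide
  have hrange : Set.range z \ C = z '' ({i | z i ∉ C} : Finset (Fin 5)) := by
    ext x
    simp only [Set.mem_sdiff, Set.mem_range, Set.mem_image, Finset.coe_filter, Finset.mem_univ,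
      true_and, Set.mem_ofPred_eq]
    grind
  rw [hrange, Set.ncard_image_of_injective _ z.injective, Set.ncard_coe_finset]
  refine hindep _ fun i hi j hj hij => ?_
  exact (hC (z.map_adj_iff.2 hij)).elim (Finset.mem_filter.1 hi).2 (Finset.mem_filter.1 hj).2

theorem isClique_setOf_mem {e : Sym2 V} (he : e ∈ G.edgeSet) : G.IsClique {x | x ∈ e} := by
  induction e with
  | _ b b' =>
    rintro x hx y hy hne
    rcases Sym2.mem_iff.1 hx with rfl | rfl <;> rcases Sym2.mem_iff.1 hy with rfl | rfl
    exacts [(hne rfl).elim, he, he.symm, (hne rfl).elim]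

theorem nonempty_setOf_mem_diff_iff {b b' : V} :
    ({x | x ∈ s(b, b')} \ C).Nonempty ↔ b ∉ C ∨ b' ∉ C := by
  simp [Set.Nonempty, or_and_right, exists_or]

variable (G Q C) in
/-- A set of vertices is economical with respect to the parts of an SCQ graph if it omits at least
as many vertices of each part as a vertex cover can: one of each simplex and each edge of `Q`, and
two of each basic 5-cycle. -/
structure IsEconomical : Prop where
  simplex : ∀ A ∈ simplexes G, (A \ C).Nonempty
  fiveCycle : ∀ A ∈ basicFiveCycles G, (A \ C).Nontrivial
  edge : ∀ e ∈ Q, ({x | x ∈ e} \ C).Nonempty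

theorem IsEconomical.ncard_diff_le [Finite V] (h : IsEconomical G Q C) (hQ : IsSCQ G Q)
    (hC' : G.IsVertexCover C') {A : Set V}
    (hA : A ∈ simplexes G ∪ basicFiveCycles G ∪ {A | ∃ e ∈ Q, A = {x | x ∈ e}}) :
    (A \ C').ncard ≤ (A \ C).ncard := by
  rcases hA with (hA | hA) | ⟨e, he, rfl⟩
  · exact (Set.ncard_le_one_iff_subsingleton.2
      (subsingleton_diff_of_isClique hA.choose_spec.2 hC')).trans
      ((Set.ncard_pos (Set.toFinite _)).2 (h.simplex A hA))
  · obtain ⟨z, -, rfl⟩ := id hA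
    exact (ncard_range_diff_le_two z hC').trans
      (Set.one_lt_ncard_iff_nontrivial.2 (h.fiveCycle _ hA))
  · exact (Set.ncard_le_one_iff_subsingleton.2
      (subsingleton_diff_of_isClique (isClique_setOf_mem (hQ.matching.1 he)) hC')).trans
      ((Set.ncard_pos (Set.toFinite _)).2 (h.edge e he))

theorem IsEconomical.ncard_eq_iff [Finite V] (h : IsEconomical G Q C) (hQ : IsSCQ G Q)
    (hC : G.IsVertexCover C) (hC' : G.IsVertexCover C') :
    C.ncard = C'.ncard ↔ IsEconomical G Q C' := by
  refine ⟨fun hcard => ?_, fun h' => ?_⟩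
  · have heq {A : Set V} := ncard_diff_eq_of_ncard_eq hQ.partition
      (fun _ => h.ncard_diff_le hQ hC') hcard (A := A)
    refine ⟨fun A hA => ?_, fun A hA => ?_, fun e he => ?_⟩
    · rw [← Set.ncard_pos, heq (Or.inl (Or.inl hA))]
      exact (Set.ncard_pos (Set.toFinite _)).2 (h.simplex A hA)
    · rw [← Set.one_lt_ncard_iff_nontrivial, heq (Or.inl (Or.inr hA))]
      exact Set.one_lt_ncard_iff_nontrivial.2 (h.fiveCycle A hA)
    · rw [← Set.ncard_pos, heq (Or.inr ⟨e, he, rfl⟩)]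
      exact (Set.ncard_pos (Set.toFinite _)).2 (h.edge e he)
  · exact (ncard_le_ncard_of_isPartition hQ.partition fun _ => h.ncard_diff_le hQ hC').antisymm
      (ncard_le_ncard_of_isPartition hQ.partition fun _ => h'.ncard_diff_le hQ hC)

theorem isEconomical_of_forall_not_subset [Finite V] (hQ : IsSCQ G Q) (hC : G.IsVertexCover C)
    (hmin : ∀ x ∈ C, ¬ G.neighborSet x ⊆ C) : IsEconomical G Q C where
  simplex := by
    rintro _ ⟨v, rfl, -⟩
    refine Set.sdiff_nonempty.2 fun hsub => hmin v (hsub (Set.mem_insert _ _)) ?_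
    exact (Set.subset_insert _ _).trans hsub
  fiveCycle := by
    rintro _ ⟨z, hz, rfl⟩
    by_contra hnt
    obtain ⟨y, hyz, hyC, hy1⟩ := hz.exists_relabelling hnt
    refine hmin (y 1) (hyC 1 (by decide)) fun v hv => ?_
    obtain ⟨i, rfl⟩ := hyz ▸ hy1 hv
    exact hyC i ((by decide : ∀ i, (cycleGraph 5).Adj 1 i → i ≠ 4) i (y.map_adj_iff.1 hv))
  edge e he := by
    induction e with
    | _ b b' =>
      rw [nonempty_setOf_mem_diff_iff]
      exact ((hQ.propertyP _ he).neighborSet_subset_or hC).imp (fun h hb => hmin b hb h)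
        fun h hb' => hmin b' hb' h

end SCQ

theorem WOGraph.isUnmixed_edgeIdeal_iff_forall_isEconomical {V : Type*} [Finite V]
    {D : WOGraph V} (K : Type*) [Field K] {Q : Set (Sym2 V)} (hQ : SCQ.IsSCQ D.graph Q) :
    IdealIsUnmixed (D.edgeIdeal K) ↔ ∀ C, D.IsStrong C → SCQ.IsEconomical D.graph Q C := by
  obtain ⟨C₀, hC₀, -, -, hmin⟩ := exists_isVertexCover_disjoint (G := D.graph)
    (S := ∅) (B := ∅) (by simp) (Set.disjoint_empty _)
  have hmin' : ∀ x ∈ C₀, ¬ D.graph.neighborSet x ⊆ C₀ := hmin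
  have h₀ := SCQ.isEconomical_of_forall_not_subset hQ hC₀ hmin'
  have hstrong : D.IsStrong C₀ :=
    ⟨hC₀, fun x hx hN => (hmin' x hx (nbr_eq_neighborSet x ▸ hN)).elim⟩
  rw [isUnmixed_edgeIdeal_iff]
  refine ⟨fun h C hC => (h₀.ncard_eq_iff hQ hC₀ hC.1).1 (h C₀ C hstrong hC),
    fun h C C' hC hC' => ((h C hC).ncard_eq_iff hQ hC.1 hC'.1).2 (h C' hC')⟩

/-! ### Star-semi-forests give strong vertex covers -/

namespace WOGraph

variable {V : Type*} {D : WOGraph V}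

namespace Sub

/-- `H` is the vertex-disjoint union of the subgraphs `P k`. -/
structure IsDisjointUnion {κ : Type*} (H : D.Sub) (P : κ → D.Sub) : Prop where
  verts_eq : H.verts = ⋃ k, (P k).verts
  arc_iff : ∀ x y, H.arc x y ↔ ∃ k, (P k).arc x y
  pairwise_disjoint : Pairwise fun k l => Disjoint (P k).verts (P l).verts

theorem isDisjointUnion_sumElim_iff {ι κ : Type*} {H : D.Sub} {T : ι → D.Sub} {B : κ → D.Sub} :
    H.IsDisjointUnion (Sum.elim T B) ↔
      H.verts = (⋃ i, (T i).verts) ∪ (⋃ j, (B j).verts) ∧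
      (∀ x y, H.arc x y ↔ (∃ i, (T i).arc x y) ∨ (∃ j, (B j).arc x y)) ∧
      (∀ i i', i ≠ i' → Disjoint (T i).verts (T i').verts) ∧
      (∀ j j', j ≠ j' → Disjoint (B j).verts (B j').verts) ∧
      (∀ i j, Disjoint (T i).verts (B j).verts) := by
  constructor
  · rintro ⟨hverts, harc, hdisj⟩
    refine ⟨by simpa [Set.iUnion_sum] using hverts, by simpa using harc,
      fun i i' h => hdisj (Sum.inl_injective.ne h), fun j j' h => hdisj (Sum.inr_injective.ne h),
      fun i j => hdisj Sum.inl_ne_inr⟩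
  · rintro ⟨hverts, harc, hTT, hBB, hTB⟩
    refine ⟨by simpa [Set.iUnion_sum] using hverts, by simpa using harc, ?_⟩
    rintro (i | j) (i' | j') hne
    · exact hTT i i' (ne_of_apply_ne _ hne)
    · exact hTB i j'
    · exact (hTB i' j).symm
    · exact hBB j j' (ne_of_apply_ne _ hne)

theorem IsDisjointUnion.deg_eq {κ : Type*} {H : D.Sub} {P : κ → D.Sub}
    (h : H.IsDisjointUnion P) {k : κ} {x : V} (hx : x ∈ (P k).verts) : H.deg x = (P k).deg x := by
  have hk {l : κ} (hl : x ∈ (P l).verts) : l = k := by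
    by_contra hne
    exact Set.disjoint_left.1 (h.pairwise_disjoint hne) hl hx
  have hadj (y : V) : H.under.Adj x y ↔ (P k).under.Adj x y := by
    refine or_congr ((h.arc_iff x y).trans ⟨?_, fun hxy => ⟨k, hxy⟩⟩)
      ((h.arc_iff y x).trans ⟨?_, fun hyx => ⟨k, hyx⟩⟩)
    · rintro ⟨l, hl⟩
      exact hk ((P l).left_mem x y hl) ▸ hl
    · rintro ⟨l, hl⟩
      exact hk ((P l).right_mem y x hl) ▸ hl
  exact congrArg Set.ncard (Set.ext hadj)

theorem two_le_deg [Finite V] {P : D.Sub} {x y z : V} (hy : P.under.Adj x y)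
    (hz : P.under.Adj x z) (hne : y ≠ z) : 2 ≤ P.deg x := by
  rw [← Set.ncard_pair hne]
  exact Set.ncard_le_ncard (Set.pair_subset hy hz)

theorem deg_pos_iff [Finite V] {P : D.Sub} {x : V} : 0 < P.deg x ↔ ∃ y, P.under.Adj x y :=
  Set.ncard_pos (Set.toFinite _)

theorem mem_plus_of_weight_ne_one {x : V} (hx : D.weight x ≠ 1) : x ∈ D.plus :=
  lt_of_le_of_ne (D.weight_pos x) (Ne.symm hx)

theorem IsUnicycle.mem_plus {B : D.Sub} (hB : B.IsUnicycle) {x : V} (hx : x ∈ B.verts)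
    (hdeg : 2 ≤ B.deg x) : x ∈ D.plus := by
  refine mem_plus_of_weight_ne_one fun hw => ?_
  have := hB.2 x hx hw
  omega

theorem IsROT.mem_plus [Finite V] {T : D.Sub} {v : V} (hT : T.IsROT v) {x : V} (hx : x ∈ T.verts)
    (hdeg : 2 ≤ T.deg x ∨ x = v ∧ T.deg v = 1) : x ∈ D.plus := by
  refine mem_plus_of_weight_ne_one fun hw => ?_
  rcases hT.2.2.2 x hx hw with ⟨hone, hxv⟩ | ⟨hverts, rfl⟩
  · rcases hdeg with h | ⟨h, -⟩
    · omega
    · exact hxv h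
  · obtain ⟨y, hy⟩ := deg_pos_iff.1 (show 0 < T.deg x by omega)
    have hyT : y ∈ T.verts := hy.elim (T.right_mem x y) (T.left_mem y x)
    rw [hverts] at hyT
    exact hy.ne hyT.symm

theorem exists_arc_of_isPath {P : D.Sub} {u x : V} (p : P.under.Walk u x) (hp : p.IsPath)
    (ho : P.IsOriented p) (hne : u ≠ x) :
    ∃ y, P.arc y x ∧ (y = u ∨ ∃ y', P.arc y' y ∧ y' ≠ x) := by
  induction p with
  | nil => exact absurd rfl hne
  | @cons u v x h q ih =>
    have huv : P.arc u v := ho ⟨(u, v), h⟩ (by simp)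
    by_cases hvx : v = x
    · exact ⟨u, hvx ▸ huv, Or.inl rfl⟩
    · obtain ⟨y, hyx, hy⟩ := ih hp.of_cons (fun d hd => ho d (by simp [hd])) hvx
      refine ⟨y, hyx, Or.inr ?_⟩
      rcases hy with rfl | h
      · exact ⟨u, huv, hne⟩
      · exact h

theorem HasOrientedPath.exists_arc [Finite V] {P : D.Sub} {u x : V} (h : P.HasOrientedPath u x)
    (hne : u ≠ x) : ∃ y, P.arc y x ∧ (y = u ∨ 2 ≤ P.deg y) := by
  obtain ⟨p, hp, ho⟩ := h
  obtain ⟨y, hyx, hy⟩ := exists_arc_of_isPath p hp ho hne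
  exact ⟨y, hyx, hy.imp_right fun ⟨y', hy', hne⟩ => two_le_deg (Or.inr hy') (Or.inl hyx) hne⟩

theorem IsOriented.exists_arc_of_mem_support {P : D.Sub} {u : V} {c : P.under.Walk u u}
    (ho : P.IsOriented c) (hc : ¬ c.Nil) {x : V} (hx : x ∈ c.support) :
    ∃ y ∈ c.support, P.arc y x ∧ s(y, x) ∈ c.edges := by
  have htail : x ∈ c.support.tail := by
    rcases c.mem_support_iff.1 hx with rfl | h
    · exact c.end_mem_tail_support hc
    · exact h
  rw [← SimpleGraph.Walk.map_snd_darts, List.mem_map] at htail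
  obtain ⟨d, hd, rfl⟩ := htail
  exact ⟨d.fst, c.dart_fst_mem_support_of_mem_darts hd, ho d hd, List.mem_map_of_mem hd⟩

theorem two_le_deg_of_isCycle [Finite V] {P : D.Sub} {u : V} {c : P.under.Walk u u}
    (hc : c.IsCycle) {x : V} (hx : x ∈ c.support) : 2 ≤ P.deg x := by
  rw [← hc.ncard_neighborSet_toSubgraph_eq_two hx]
  exact Set.ncard_le_ncard (c.toSubgraph.neighborSet_subset x)

theorem IsUnicycle.exists_arc [Finite V] {B : D.Sub} (hB : B.IsUnicycle) {x : V}
    (hx : x ∈ B.verts) : ∃ y, B.arc y x ∧ 2 ≤ B.deg y := by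
  obtain ⟨⟨u, c, hc, -, ho, hpath⟩, -⟩ := hB
  by_cases hxc : x ∈ c.support
  · obtain ⟨y, hy, hyx, -⟩ := ho.exists_arc_of_mem_support hc.not_nil hxc
    exact ⟨y, hyx, two_le_deg_of_isCycle hc hy⟩
  · obtain ⟨z, hz, hzx⟩ := hpath x hx hxc
    obtain ⟨y, hyx, hy⟩ := hzx.exists_arc (ne_of_mem_of_not_mem hz hxc)
    exact ⟨y, hyx, hy.elim (fun h => h ▸ two_le_deg_of_isCycle hc hz) id⟩

theorem IsROT.exists_arc [Finite V] {T : D.Sub} {v : V} (hT : T.IsROT v) {x : V}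
    (hx : x ∈ T.verts) (hne : x ≠ v) :
    ∃ y, T.arc y x ∧ (2 ≤ T.deg y ∨ y = v ∧ T.deg v = 1) := by
  obtain ⟨y, hyx, hy⟩ := (hT.2.2.1 x hx hne).exists_arc hne.symm
  refine ⟨y, hyx, or_iff_not_imp_left.2 fun hdeg => ?_⟩
  obtain rfl := hy.resolve_right hdeg
  have : 0 < T.deg y := deg_pos_iff.2 ⟨x, Or.inl hyx⟩
  exact ⟨rfl, by omega⟩

theorem IsStarSemiForest.exists_isStrong [Finite V] {H : D.Sub} (hH : H.IsStarSemiForest) :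
    ∃ C, D.IsStrong C ∧ H.verts ⊆ C := by
  obtain ⟨r, s, T, v, B, hT, hB, hverts, harc, hTT, hBB, hTB, w, hw, W₁, W₂, hW, -, hind, hplus,
    hW₂, hout⟩ := hH
  have hH := isDisjointUnion_sumElim_iff.2 ⟨hverts, harc, hTT, hBB, hTB⟩
  have hdegT {i : Fin r} {x : V} (hx : x ∈ (T i).verts) : H.deg x = (T i).deg x :=
    hH.deg_eq (k := Sum.inl i) hx
  have hdegB {j : Fin s} {x : V} (hx : x ∈ (B j).verts) : H.deg x = (B j).deg x :=
    hH.deg_eq (k := Sum.inr j) hx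
  have hcases {x : V} (hx : x ∈ H.verts) : (∃ i, x ∈ (T i).verts) ∨ ∃ j, x ∈ (B j).verts := by
    simpa only [hverts, Set.mem_union, Set.mem_iUnion] using hx
  obtain ⟨C, hC, hS, hA⟩ := WOGraph.exists_isStrong hind (A := W₂ ∪
    ({x | x ∈ H.verts ∧ 2 ≤ H.deg x} ∪ {x | ∃ i, x = v i ∧ H.deg (v i) = 1})) (by
      rintro x (hx | ⟨hx, hdeg⟩ | ⟨i, rfl, hdeg⟩)
      · exact hplus hx
      · rcases hcases hx with ⟨i, hi⟩ | ⟨j, hj⟩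
        · exact (hT i).mem_plus hi (Or.inl (hdegT hi ▸ hdeg))
        · exact (hB j).mem_plus hj (hdegB hj ▸ hdeg)
      · exact (hT i).mem_plus (hT i).1 (Or.inr ⟨rfl, hdegT (hT i).1 ▸ hdeg⟩)) hout
  refine ⟨C, hC, fun x hx => ?_⟩
  rcases hcases hx with ⟨i, hi⟩ | ⟨j, hj⟩
  · rcases eq_or_ne x (v i) with rfl | hne
    · rcases (hW ▸ Set.mem_range_self i : w i ∈ W₁ ∪ W₂) with h | h
      · exact hS _ h (mem_nbr_comm.1 (hw i).2)
      · exact hA _ (Or.inl h) (hW₂ i h)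
    · obtain ⟨y, hyx, hy⟩ := (hT i).exists_arc hi hne
      have hyx' := (harc y x).2 (Or.inl ⟨i, hyx⟩)
      rw [← hdegT ((T i).left_mem y x hyx), ← hdegT (hT i).1] at hy
      exact hA y (Or.inr (hy.imp (⟨H.left_mem y x hyx', ·⟩) (⟨i, ·⟩))) (H.arc_le y x hyx')
  · obtain ⟨y, hyx, hy⟩ := (hB j).exists_arc hj
    have hyx' := (harc y x).2 (Or.inr ⟨j, hyx⟩)
    rw [← hdegB ((B j).left_mem y x hyx)] at hy
    exact hA y (Or.inr (Or.inl ⟨H.left_mem y x hyx', hy⟩)) (H.arc_le y x hyx')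

end Sub

end WOGraph

/-! ### Left-unique relations -/

section LeftUnique

open Relation Relator

variable {α : Type*} {R : α → α → Prop}

theorem reflTransGen_or_of_leftUnique (hR : LeftUnique R) {a b x : α} (ha : ReflTransGen R a x)
    (hb : ReflTransGen R b x) : ReflTransGen R a b ∨ ReflTransGen R b a := by
  rw [← reflTransGen_swap] at ha hb
  exact (ha.total_of_right_unique hR.flip hb).symm.imp reflTransGen_swap.1 reflTransGen_swap.1

/-- An element that reaches everything by which it is reached. Under a left-unique relation these
are the elements without predecessor and the elements on cycles: the possible starting points of the
components. -/
def IsInitial (R : α → α → Prop) (v : α) : Prop :=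
  ∀ y, ReflTransGen R y v → ReflTransGen R v y

theorem IsInitial.transGen_self {v y : α} (hv : IsInitial R v) (hy : R y v) : TransGen R v v :=
  .tail' (hv y (.single hy)) hy

theorem exists_isInitial_reflTransGen [Finite α] (R : α → α → Prop) (x : α) :
    ∃ v, IsInitial R v ∧ ReflTransGen R v x := by
  obtain ⟨v, hvx, hmin⟩ := (Set.toFinite {v | ReflTransGen R v x}).exists_minimalFor
    (fun v => {y | ReflTransGen R y v}) _ ⟨x, .refl⟩
  exact ⟨v, fun y hyv => hmin (hyv.trans hvx) (fun z hzy => hzy.trans hyv)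
    (show v ∈ {z | ReflTransGen R z v} from .refl), hvx⟩

theorem exists_isInitial_transversal [Finite α] (hR : LeftUnique R) :
    ∃ S : Set α, (∀ v ∈ S, IsInitial R v) ∧ ∀ x, ∃! v, v ∈ S ∧ ReflTransGen R v x := by
  obtain ⟨S, hS, hbij⟩ := (Set.surjOn_image (fun v => {y | ReflTransGen R y v})
    {v | IsInitial R v}).exists_bijOn_subset
  refine ⟨S, hS, fun x => existsUnique_of_exists_of_unique ?_ ?_⟩
  · obtain ⟨u, hu, hux⟩ := exists_isInitial_reflTransGen R x
    obtain ⟨v, hv, hvu⟩ := hbij.surjOn ⟨u, hu, rfl⟩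
    exact ⟨v, hv, (show ReflTransGen R v u from hvu.le ReflTransGen.refl).trans hux⟩
  · rintro u v ⟨hu, hux⟩ ⟨hv, hvx⟩
    have huv : ReflTransGen R u v ∧ ReflTransGen R v u := by
      rcases reflTransGen_or_of_leftUnique hR hux hvx with h | h
      · exact ⟨h, hS hv u h⟩
      · exact ⟨hS hu v h, h⟩
    exact hbij.injOn hu hv (Set.ext fun y => ⟨fun h => h.trans huv.1, fun h => h.trans huv.2⟩)

end LeftUnique

/-! ### Subgraphs in which every vertex has at most one in-neighbour -/

namespace WOGraph

open Relation Relator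

variable {V : Type*} {D : WOGraph V}

namespace Sub

section Cycles

variable {P : D.Sub}

theorem isOriented_cons {u v x : V} {h : P.under.Adj u v} {p : P.under.Walk v x} :
    P.IsOriented (.cons h p) ↔ P.arc u v ∧ P.IsOriented p := by
  simp [IsOriented]

theorem IsOriented.reflTransGen {u x : V} {p : P.under.Walk u x} (hp : P.IsOriented p) :
    ReflTransGen P.arc u x := by
  induction p with
  | nil => exact .refl
  | cons h p ih => exact .head (isOriented_cons.1 hp).1 (ih (isOriented_cons.1 hp).2)

theorem hasOrientedPath_of_reflTransGen {u x : V} (h : ReflTransGen P.arc u x) :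
    P.HasOrientedPath u x := by
  classical
  suffices ∃ p : P.under.Walk u x, P.IsOriented p by
    obtain ⟨p, hp⟩ := this
    exact ⟨p.bypass, p.bypass_isPath, fun d hd => hp d (p.darts_bypass_subset_darts hd)⟩
  induction h using ReflTransGen.head_induction_on with
  | refl => exact ⟨.nil, by simp [IsOriented]⟩
  | head hab _ ih =>
    obtain ⟨p, hp⟩ := ih
    exact ⟨.cons (Or.inl hab) p, isOriented_cons.2 ⟨hab, hp⟩⟩

theorem IsOriented.reflTransGen_of_mem_support {u : V} {c : P.under.Walk u u}
    (ho : P.IsOriented c) {x y : V} (hx : x ∈ c.support) (hy : y ∈ c.support) :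
    ReflTransGen P.arc x y := by
  classical
  have hxu : P.IsOriented (c.dropUntil x hx) := fun d hd =>
    ho d (c.darts_dropUntil_subset_darts hx hd)
  have huy : P.IsOriented (c.takeUntil y hy) := fun d hd =>
    ho d (c.darts_takeUntil_subset_darts hy hd)
  exact hxu.reflTransGen.trans huy.reflTransGen

theorem exists_isCycle_isOriented {p : V} (hp : TransGen P.arc p p) :
    ∃ (u : V) (c : P.under.Walk u u), c.IsCycle ∧ P.IsOriented c ∧ p ∈ c.support := by
  obtain ⟨q, hpq, hqp⟩ := TransGen.tail'_iff.1 hp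
  obtain ⟨w, hw, ho⟩ := hasOrientedPath_of_reflTransGen hpq
  refine ⟨q, .cons (Or.inl hqp) w, (SimpleGraph.Walk.cons_isCycle_iff ..).2 ⟨hw, fun he => ?_⟩,
    isOriented_cons.2 ⟨hqp, ho⟩, List.mem_cons_of_mem _ w.start_mem_support⟩
  obtain ⟨d, hd, hde⟩ := List.mem_map.1 he
  rcases Sym2.eq_iff.1 hde with ⟨-, hsnd⟩ | ⟨hfst, hsnd⟩
  · have hp' : p ∈ w.support.tail := by
      rw [← SimpleGraph.Walk.map_snd_darts]
      exact List.mem_map.2 ⟨d, hd, hsnd⟩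
    have hnodup := hw.support_nodup
    rw [← w.cons_tail_support, List.nodup_cons] at hnodup
    exact hnodup.1 hp'
  · exact D.asymm q p (P.arc_le q p hqp) (P.arc_le p q (hfst ▸ hsnd ▸ ho d hd))

theorem isOriented_of_isTrail (hP : LeftUnique P.arc) {x y z : V} {p : P.under.Walk x z}
    (hp : p.IsTrail) (hyx : P.arc y x) (hne : s(y, x) ∉ p.edges) : P.IsOriented p := by
  induction p generalizing y with
  | nil => simp [IsOriented]
  | @cons x v z h p ih =>
    rw [SimpleGraph.Walk.edges_cons, List.mem_cons, not_or] at hne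
    have hxv : P.arc x v := h.resolve_right fun hvx => hne.1 (hP hyx hvx ▸ Sym2.eq_swap)
    rw [SimpleGraph.Walk.isTrail_cons] at hp
    exact isOriented_cons.2 ⟨hxv, ih hp.1 hxv hp.2⟩

theorem exists_isOriented_edges_eq (hP : LeftUnique P.arc) {u : V} {c : P.under.Walk u u}
    (hc : c.IsCycle) : ∃ (v : V) (c' : P.under.Walk v v),
      ¬ c'.Nil ∧ P.IsOriented c' ∧ ∀ e, e ∈ c'.edges ↔ e ∈ c.edges := by
  cases c with
  | nil => exact absurd hc SimpleGraph.Walk.not_isCycle_nil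
  | @cons _ v _ h p =>
    obtain ⟨hp, hne⟩ := (SimpleGraph.Walk.isTrail_cons ..).1 hc.isTrail
    rcases id h with huv | hvu
    · exact ⟨u, .cons h p, hc.not_nil,
        isOriented_cons.2 ⟨huv, isOriented_of_isTrail hP hp huv hne⟩, fun _ => Iff.rfl⟩
    · refine ⟨v, .cons h.symm p.reverse, by simp, isOriented_cons.2 ⟨hvu, isOriented_of_isTrail hP
        (SimpleGraph.Walk.IsTrail.reverse p hp) hvu ?_⟩, fun e => ?_⟩
      · simpa [Sym2.eq_swap] using hne
      · simp [Sym2.eq_swap]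

theorem IsOriented.mem_support_of_reflTransGen (hP : LeftUnique P.arc) {u : V}
    {c : P.under.Walk u u} (ho : P.IsOriented c) (hc : ¬ c.Nil) {v x : V}
    (hvx : ReflTransGen P.arc v x) (hx : x ∈ c.support) : v ∈ c.support := by
  induction hvx with
  | refl => exact hx
  | tail _ hyx ih =>
    obtain ⟨z, hz, hzx, -⟩ := ho.exists_arc_of_mem_support hc hx
    exact ih (hP hzx hyx ▸ hz)

theorem IsOriented.mem_edges_iff (hP : LeftUnique P.arc) {u : V} {c : P.under.Walk u u}
    (ho : P.IsOriented c) (hc : ¬ c.Nil) {p : V} (hp : p ∈ c.support) (e : Sym2 V) :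
    e ∈ c.edges ↔ ∃ y x, P.arc y x ∧ ReflTransGen P.arc x p ∧ e = s(y, x) := by
  constructor
  · intro he
    obtain ⟨d, hd, rfl⟩ := List.mem_map.1 he
    exact ⟨d.fst, d.snd, ho d hd,
      ho.reflTransGen_of_mem_support (c.dart_snd_mem_support_of_mem_darts hd) hp, rfl⟩
  · rintro ⟨y, x, hyx, hxp, rfl⟩
    obtain ⟨z, -, hzx, he⟩ := ho.exists_arc_of_mem_support hc
      (ho.mem_support_of_reflTransGen hP hc hxp hp)
    exact hP hzx hyx ▸ he

/-- Reachability from `p` makes every cycle pass through `p`: it can be traversed along the arcs,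
and then it contains all ancestors of its vertices. -/
theorem mem_edges_iff_of_isCycle (hP : LeftUnique P.arc) {p : V}
    (hreach : ∀ x ∈ P.verts, ReflTransGen P.arc p x) {u : V} {c : P.under.Walk u u}
    (hc : c.IsCycle) (e : Sym2 V) :
    e ∈ c.edges ↔ ∃ y x, P.arc y x ∧ ReflTransGen P.arc x p ∧ e = s(y, x) := by
  obtain ⟨v, c', hnil, ho, hedges⟩ := exists_isOriented_edges_eq hP hc
  obtain ⟨y, -, hyv, -⟩ := ho.exists_arc_of_mem_support hnil c'.start_mem_support
  rw [← hedges]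
  exact ho.mem_edges_iff hP hnil (ho.mem_support_of_reflTransGen hP hnil
    (hreach v (P.right_mem y v hyv)) c'.start_mem_support) e

end Cycles

/-- The subgraph of the vertices that are reached from `v`. -/
def descendants (H : D.Sub) (v : V) : D.Sub where
  verts := {x | x ∈ H.verts ∧ ReflTransGen H.arc v x}
  arc x y := H.arc x y ∧ ReflTransGen H.arc v x
  arc_le x y h := H.arc_le x y h.1
  left_mem x y h := ⟨H.left_mem x y h.1, h.2⟩
  right_mem x y h := ⟨H.right_mem x y h.1, h.2.tail h.1⟩

section Descendants

variable {H : D.Sub}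

theorem reflTransGen_descendants {v x : V} (h : ReflTransGen H.arc v x) :
    ReflTransGen (H.descendants v).arc v x := by
  induction h with
  | refl => exact .refl
  | tail hb hbc ih => exact ih.tail ⟨hbc, hb⟩

theorem leftUnique_descendants (hH : LeftUnique H.arc) (v : V) :
    LeftUnique (H.descendants v).arc :=
  fun _ _ _ h h' => hH h.1 h'.1

theorem deg_eq_one_of_arc (hH : LeftUnique H.arc) {x y : V} (hyx : H.arc y x)
    (hx : ∀ z, ¬ H.arc x z) : H.deg x = 1 := by
  refine Set.ncard_eq_one.2 ⟨y, Set.ext fun z => ⟨?_, ?_⟩⟩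
  · rintro (hxz | hzx)
    · exact absurd hxz (hx z)
    · exact hH hzx hyx
  · rintro rfl
    exact Or.inr hyx

theorem isROT_descendants (hH : LeftUnique H.arc) (hplus : ∀ x y, H.arc x y → x ∈ D.plus) {v : V}
    (hv : v ∈ H.verts) (hroot : ∀ y, ¬ H.arc y v) : (H.descendants v).IsROT v := by
  have hP := leftUnique_descendants hH v
  refine ⟨⟨hv, .refl⟩, fun u c hc => ?_, fun x hx _ =>
    hasOrientedPath_of_reflTransGen (reflTransGen_descendants hx.2), fun x hx hw => ?_⟩
  · obtain ⟨u', c', hnil, ho, -⟩ := exists_isOriented_edges_eq hP hc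
    obtain ⟨y, -, hyu, -⟩ := ho.exists_arc_of_mem_support hnil c'.start_mem_support
    have hvc : v ∈ c'.support := ho.mem_support_of_reflTransGen hP hnil
      (reflTransGen_descendants ((H.descendants v).right_mem y u' hyu).2) c'.start_mem_support
    obtain ⟨z, -, hzv, -⟩ := ho.exists_arc_of_mem_support hnil hvc
    exact hroot z hzv.1
  · have hleaf (z : V) : ¬ H.arc x z := fun hxz => (hplus x z hxz).ne' hw
    rcases ReflTransGen.cases_tail hx.2 with rfl | ⟨y, hvy, hyx⟩
    · refine Or.inr ⟨Set.ext fun y => ⟨fun hy => ?_, ?_⟩, rfl⟩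
      · rcases ReflTransGen.cases_head hy.2 with rfl | ⟨z, hz, -⟩
        · rfl
        · exact absurd hz (hleaf z)
      · rintro rfl
        exact hx
    · exact Or.inl ⟨deg_eq_one_of_arc hP ⟨hyx, hvy⟩ fun z hz => hleaf z hz.1,
        fun h => hroot y (h ▸ hyx)⟩

theorem isUnicycle_descendants (hH : LeftUnique H.arc) (hplus : ∀ x y, H.arc x y → x ∈ D.plus)
    {p : V} (hp : TransGen H.arc p p) : (H.descendants p).IsUnicycle := by
  have hP := leftUnique_descendants hH p
  have hreach (x : V) (hx : x ∈ (H.descendants p).verts) :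
      ReflTransGen (H.descendants p).arc p x := reflTransGen_descendants hx.2
  have hp' : TransGen (H.descendants p).arc p p := by
    obtain ⟨q, hpq, hqp⟩ := TransGen.tail'_iff.1 hp
    exact .tail' (reflTransGen_descendants hpq) ⟨hqp, hpq⟩
  obtain ⟨u, c, hc, ho, hpc⟩ := exists_isCycle_isOriented hp'
  refine ⟨⟨u, c, hc, fun u' c' hc' e => ?_, ho, fun y hy _ =>
    ⟨p, hpc, hasOrientedPath_of_reflTransGen (hreach y hy)⟩⟩, fun x hx hw => ?_⟩
  · rw [mem_edges_iff_of_isCycle hP hreach hc, mem_edges_iff_of_isCycle hP hreach hc']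
  · obtain ⟨y, -, hyx⟩ := TransGen.tail'_iff.1 (hp'.trans_left (hreach x hx))
    exact deg_eq_one_of_arc hP hyx fun z hxz => (hplus x z hxz.1).ne' hw

theorem mem_verts_of_reflTransGen {v x : V} (h : ReflTransGen H.arc v x) (hx : x ∈ H.verts) :
    v ∈ H.verts := by
  rcases ReflTransGen.cases_head h with rfl | ⟨y, hvy, -⟩
  · exact hx
  · exact H.left_mem v y hvy

theorem isDisjointUnion_descendants {κ : Type*} {q : κ → V}
    (hq : ∀ x ∈ H.verts, ∃! k, ReflTransGen H.arc (q k) x) :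
    H.IsDisjointUnion fun k => H.descendants (q k) where
  verts_eq := Set.ext fun x => by
    rw [Set.mem_iUnion]
    exact ⟨fun hx => (hq x hx).exists.imp fun _ h => ⟨hx, h⟩, fun ⟨_, h⟩ => h.1⟩
  arc_iff x y :=
    ⟨fun h => (hq x (H.left_mem x y h)).exists.imp fun _ hk => ⟨h, hk⟩, fun ⟨_, h⟩ => h.1⟩
  pairwise_disjoint _ _ hne := Set.disjoint_left.2 fun x hk hl =>
    hne ((hq x hk.1).unique hk.2 hl.2)

theorem exists_isDisjointUnion_descendants [Finite V] (hH : LeftUnique H.arc) :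
    ∃ (r s : ℕ) (v : Fin r → V) (p : Fin s → V),
      (∀ i, v i ∈ H.verts) ∧ (∀ i y, ¬ H.arc y (v i)) ∧ (∀ j, TransGen H.arc (p j) (p j)) ∧
      H.IsDisjointUnion
        (Sum.elim (fun i => H.descendants (v i)) fun j => H.descendants (p j)) := by
  obtain ⟨S, hS, hreach⟩ := exists_isInitial_transversal hH
  obtain ⟨r, v, hv⟩ := (Set.toFinite {x | x ∈ S ∩ H.verts ∧ ∀ y, ¬ H.arc y x}).fin_embedding
  obtain ⟨s, p, hp⟩ := (Set.toFinite {x | x ∈ S ∩ H.verts ∧ ∃ y, H.arc y x}).fin_embedding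
  have hvmem (i : Fin r) : v i ∈ S ∩ H.verts ∧ ∀ y, ¬ H.arc y (v i) := hv.le ⟨i, rfl⟩
  have hpmem (j : Fin s) : p j ∈ S ∩ H.verts ∧ ∃ y, H.arc y (p j) := hp.le ⟨j, rfl⟩
  have hinj : Function.Injective (Sum.elim v p) := v.injective.sumElim p.injective fun i j h =>
    let ⟨y, hy⟩ := (hpmem j).2
    (hvmem i).2 y (h ▸ hy)
  have hrange : Set.range (Sum.elim v p) = S ∩ H.verts := by
    rw [Set.Sum.elim_range, hv, hp]
    ext x
    simp only [Set.mem_union, Set.mem_ofPred_eq, ← and_or_left, ← not_exists, em', and_true]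
  refine ⟨r, s, v, p, fun i => (hvmem i).1.2, fun i => (hvmem i).2, fun j =>
    let ⟨_, hy⟩ := (hpmem j).2
    (hS _ (hpmem j).1.1).transGen_self hy, ?_⟩
  have hunion := isDisjointUnion_descendants (H := H) (q := Sum.elim v p) fun x hx => by
    obtain ⟨u, ⟨hu, hux⟩, huniq⟩ := hreach x
    obtain ⟨k, rfl⟩ := hrange.ge ⟨hu, mem_verts_of_reflTransGen hux hx⟩
    exact ⟨k, hux, fun l hl => hinj (huniq _ ⟨(hrange.le ⟨l, rfl⟩).1, hl⟩)⟩
  rwa [show (fun k => H.descendants (Sum.elim v p k)) = _ from Sum.comp_elim H.descendants v p]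
    at hunion

end Descendants

end Sub

end WOGraph

/-! ### Strong vertex covers give star-semi-forests -/

namespace WOGraph

open Relator

variable {V : Type*} {D : WOGraph V}

theorem IsStrong.exists_mem_nbr {C : Set V} (hC : D.IsStrong C) {x : V} (hx : x ∈ C) :
    ∃ y ∈ D.nbr x, y ∈ C → y ∈ D.plus ∧ D.arc y x ∧ D.outNbr y ⊆ C := by
  by_cases h : D.nbr x ⊆ C
  · obtain ⟨y, hy, hyx, hout⟩ := hC.2 x hx h
    exact ⟨y, Or.inr hyx, fun _ => ⟨hy, hyx, hout⟩⟩
  · obtain ⟨y, hyx, hy⟩ := Set.not_subset.1 h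
    exact ⟨y, hyx, fun h' => absurd h' hy⟩

/-- The subgraph with vertex set `A` and with an arc from `par x` to `x` for every `x ∈ A` for which
this is an arc of `D` inside `A`. -/
def parentSub (D : WOGraph V) (A : Set V) (par : V → V) : D.Sub where
  verts := A
  arc y x := D.arc y x ∧ y ∈ A ∧ x ∈ A ∧ y = par x
  arc_le _ _ h := h.1
  left_mem _ _ h := h.2.1
  right_mem _ _ h := h.2.2.1

theorem leftUnique_parentSub (A : Set V) (par : V → V) : LeftUnique (D.parentSub A par).arc :=
  fun _ _ _ h h' => h.2.2.2.trans h'.2.2.2.symm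

namespace Sub

theorem exists_arc_of_two_le_deg [Finite V] {H : D.Sub} (hH : LeftUnique H.arc) {x : V}
    (hdeg : 2 ≤ H.deg x) : ∃ y, H.arc x y := by
  obtain ⟨y, z, hy, hz, hne⟩ := (Set.one_lt_ncard_iff (Set.toFinite _)).1 hdeg
  rcases hy with hxy | hyx
  · exact ⟨y, hxy⟩
  · exact ⟨z, hz.resolve_right fun hzx => hne (hH hyx hzx)⟩

theorem hasGeneratingStarSemiForest_of_isStrong [Finite V] {C : Set V} (hC : D.IsStrong C)
    {K : D.Sub} (hK : K.verts ⊆ C) : K.HasGeneratingStarSemiForest := by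
  have hex (x : V) (hx : x ∈ C) := hC.exists_mem_nbr hx
  choose! par hnbr hpar using hex
  have hleft := leftUnique_parentSub (D := D) K.verts par
  have harc {y x : V} (h : (D.parentSub K.verts par).arc y x) :
      y ∈ D.plus ∧ D.outNbr y ⊆ C := by
    obtain ⟨-, hy, hx, rfl⟩ := h
    exact ⟨(hpar x (hK hx) (hK hy)).1, (hpar x (hK hx) (hK hy)).2.2⟩
  obtain ⟨r, s, v, p, hvK, hroot, hp, hunion⟩ := exists_isDisjointUnion_descendants hleft
  obtain ⟨hverts, harcs, hTT, hBB, hTB⟩ := isDisjointUnion_sumElim_iff.1 hunion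
  have hvC (i : Fin r) : v i ∈ C := hK (hvK i)
  have hw (i : Fin r) : par (v i) ∉ K.verts := fun h =>
    hroot i _ ⟨(hpar _ (hvC i) (hK h)).2.1, h, hvK i, rfl⟩
  have hdisj {x : V} (hx : D.outNbr x ⊆ C) :
      Disjoint (D.outNbr x) (Set.range (fun i => par (v i)) \ C) :=
    Set.disjoint_sdiff_right.mono_left hx
  refine ⟨D.parentSub K.verts par, ⟨r, s, _, v, _,
    fun i => isROT_descendants hleft (fun _ _ h => (harc h).1) (hvK i) (hroot i),
    fun j => isUnicycle_descendants hleft (fun _ _ h => (harc h).1) (hp j),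
    hverts, harcs, hTT, hBB, hTB, fun i => par (v i), fun i => ⟨hw i, hnbr _ (hvC i)⟩,
    Set.range (fun i => par (v i)) \ C, Set.range (fun i => par (v i)) ∩ C,
    Set.sdiff_union_inter _ _, Set.disjoint_sdiff_inter, ?_, ?_, ?_, ?_⟩, rfl⟩
  · rintro x ⟨-, hx⟩ y ⟨-, hy⟩ - hxy
    exact (hC.1 hxy).elim hx hy
  · rintro _ ⟨⟨i, rfl⟩, hx⟩
    exact (hpar _ (hvC i) hx).1
  · rintro i ⟨-, hx⟩
    exact (hpar _ (hvC i) hx).2.1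
  · rintro x (⟨⟨i, rfl⟩, hx⟩ | ⟨-, hdeg⟩ | ⟨i, rfl, hdeg⟩)
    · exact hdisj (hpar _ (hvC i) hx).2.2
    · obtain ⟨y, hxy⟩ := exists_arc_of_two_le_deg hleft hdeg
      exact hdisj (harc hxy).2
    · obtain ⟨y, hy⟩ := deg_pos_iff.1 (hdeg ▸ one_pos)
      exact hdisj (harc (hy.resolve_right (hroot i y))).2

theorem hasGeneratingStarSemiForest_iff [Finite V] {K : D.Sub} :
    K.HasGeneratingStarSemiForest ↔ ∃ C, D.IsStrong C ∧ K.verts ⊆ C := by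
  refine ⟨fun ⟨H, hH, hKH⟩ => hKH ▸ hH.exists_isStrong, fun ⟨C, hC, hK⟩ => ?_⟩
  exact hasGeneratingStarSemiForest_of_isStrong hC hK

theorem not_hasGeneratingStarSemiForest_induce_iff [Finite V] {A : Set V} :
    ¬ (D.induce A).HasGeneratingStarSemiForest ↔ ∀ C, D.IsStrong C → (A \ C).Nonempty := by
  simp only [hasGeneratingStarSemiForest_iff, not_exists, not_and, Set.sdiff_nonempty, induce]

end Sub

end WOGraph

theorem mainTheorem1 {V : Type*} [Finite V] (K : Type*) [Field K] (D : WOGraph V)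
    (hsource : ∀ x, D.IsSource x → D.weight x = 1)
    (Q : Set (Sym2 V)) (hQ : SCQ.IsSCQ D.graph Q) :
    IdealIsUnmixed (D.edgeIdeal K) ↔
      (∀ C ∈ SCQ.basicFiveCycles D.graph, D.HasStarProperty C) ∧
      (∀ A ∈ SCQ.simplexes D.graph, ¬ (D.induce A).HasGeneratingStarSemiForest) ∧
      (∀ a b b' : V, a ∈ D.plus → s(b, b') ∈ Q → b' ∈ D.outNbr a →
        D.nbr b ⊆ D.outNbr a) := by
  rw [WOGraph.isUnmixed_edgeIdeal_iff_forall_isEconomical K hQ]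
  constructor
  · intro h
    refine ⟨fun A hA => (WOGraph.hasStarProperty_iff_forall_isStrong hsource hA).2
        fun C hC => (h C hC).fiveCycle A hA,
      fun A hA => WOGraph.Sub.not_hasGeneratingStarSemiForest_induce_iff.2
        fun C hC => (h C hC).simplex A hA,
      fun a b b' ha he hab => WOGraph.nbr_subset_outNbr_of_forall_isStrong
        (fun C hC => SCQ.nonempty_setOf_mem_diff_iff.1 ((h C hC).edge _ he)) ha hab⟩
  · rintro ⟨hcycle, hsimplex, hedge⟩ C hC
    refine ⟨fun A hA => WOGraph.Sub.not_hasGeneratingStarSemiForest_induce_iff.1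
        (hsimplex A hA) C hC,
      fun A hA => (WOGraph.hasStarProperty_iff_forall_isStrong hsource hA).1 (hcycle A hA) C hC,
      fun e he => ?_⟩
    induction e with
    | _ b b' =>
      exact SCQ.nonempty_setOf_mem_diff_iff.2 (hC.notMem_or_notMem_of_propertyP
        (hQ.propertyP _ he) (fun a ha hab => hedge a b b' ha he hab)
        fun a ha hab => hedge a b' b ha (Sym2.eq_swap ▸ he) hab)
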